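/- Let $H$ be a separable Hilbert space and let $A$ be an unbounded positive selfadjoint operator in $H$ with domain $D(A)$ and with a complete orthonormal system of eigenvectors $\{v_k\}_{k\ge 1}$, $Av_k=\lambda_k v_k$, $0<\lambda_1\le\lambda_2\le\dots\to+\infty$. For $h\in H$ write $h_k=(h,v_k)$. For $0<\rho<1$ let $$D_t^\rho h(t)=\frac1{\Gamma(1-\rho)}\int_0^t\frac{h'(s)}{(t-s)^\rho}\,ds$$ be the Caputo derivative (it exists at $t$ if $h$ is differentiable on $(0,t)$ and the integrand is integrable there), let $E_{\rho,\mu}(z)=\sum_{n\ge0}z^n/\Gamma(\rho n+\mu)$ and $E_\rho=E_{\rho,1}$, and put $a_k(t)=t^\rho E_{\rho,\rho+1}(-\lambda_kt^\rho)$, $b_k(t)=E_\rho(-\lambda_kt^\rho)$. Let $\rho,\alpha\in(0,1)$, $0<\xi_1<\xi_0\le T$ and $K_0=\{k:\ E_\rho(-\lambda_k\xi_0^\rho)=\alpha\}$. Let $\varphi,V\in D(A)$ with $\varphi_k=0$ for all $k\in K_0$. Consider the problem of finding $u\in C([0,T];H)$ and $f\in H$ (independent of $t$) such that $D_t^\rho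 u,\ Au\in C((0,T];H)$ and $$D_t^\rho u(t)+Au(t)=f\quad(0<t\le T),\qquad u(\xi_0)=\alpha u(0)+\varphi,\qquad u(\xi_1)=V .$$ Then the set $K_0$ is finite and, unless it is empty, consists of all the indices of a single eigenvalue. For every $k$, on $[0,\infty)$ the function $a_k$ is strictly increasing and $b_k$ is positive and strictly decreasing, and $$c_k:=b_k(\xi_1)a_k(\xi_0)+a_k(\xi_1)\,[\alpha-b_k(\xi_0)]=a_k(\xi_0)b_k(\xi_1)-a_k(\xi_1)b_k(\xi_0)+\alpha a_k(\xi_1)>0 .$$ The problem has a solution $(u,f)$, which is unique ($f$ in $H$ and $u$ on $[0,T]$). Moreover $f_k=0$ for all $k\in K_0$ (so $(u,f)$ is also the unique solution among the pairs whose source $f$ satisfies this orthogonality condition), and, with convergence in $H$, $$f=\sum_{k\notin K_0}\Big[\frac{\alpha-b_k(\xi_0)}{c_k}\,V_k+\frac{b_k(\xi_1)}{c_k}\,\varphi_k\Big]v_k,$$ $$u(t)=\sum_{k\notin K_0}\Big[\frac{b_k(t)}{b_k(\xi_0)-\alpha}\,\big(\varphi_k-f_k\,a_k(\xi_0)\big)+f_k\,a_k(t)\Big]v_k+\sum_{k\in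 K_0}\frac{b_k(t)}{b_k(\xi_1)}\,V_k\,v_k,\qquad 0\le t\le T .$$ -/

import Mathlib

open Set Filter MeasureTheory

/-- The two-parameter Mittag-Leffler function `E_{ρ,μ}(z) = ∑ z ^ n / Γ(ρ n + μ)`,
for real parameters and a real argument. -/
noncomputable def mittagLeffler (ρ μ z : ℝ) : ℝ :=
  ∑' n : ℕ, z ^ n / Real.Gamma (ρ * n + μ)

/-- `b(t) = E_ρ(-l t ^ ρ)`, where `E_ρ = E_{ρ,1}`. -/
noncomputable def mlB (ρ l t : ℝ) : ℝ :=
  mittagLeffler ρ 1 (-l * t ^ ρ)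

/-- `a(t) = t ^ ρ E_{ρ,ρ+1}(-l t ^ ρ)`. -/
noncomputable def mlA (ρ l t : ℝ) : ℝ :=
  t ^ ρ * mittagLeffler ρ (ρ + 1) (-l * t ^ ρ)

section Caputo

variable {H : Type*} [NormedAddCommGroup H] [NormedSpace ℝ H]

/-- The expression defining the Caputo derivative of order `ρ` of `h` at `t` exists:
`h` is differentiable on `(0, t)` and `s ↦ h'(s) / (t - s) ^ ρ` is (Bochner) integrable there. -/
def CaputoExistsAt (ρ : ℝ) (h : ℝ → H) (t : ℝ) : Prop :=
  (∀ s ∈ Ioo 0 t, DifferentiableAt ℝ h s) ∧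
    IntervalIntegrable (fun s => (1 / (t - s) ^ ρ) • deriv h s) volume 0 t

/-- The Caputo derivative
`D_t^ρ h (t) = 1 / Γ(1 - ρ) * ∫_0^t h'(s) / (t - s) ^ ρ ds`. -/
noncomputable def caputoDeriv (ρ : ℝ) (h : ℝ → H) (t : ℝ) : H :=
  (1 / Real.Gamma (1 - ρ)) • ∫ s in (0 : ℝ)..t, (1 / (t - s) ^ ρ) • deriv h s

end Caputo

/-- The set of indices of critical eigenvalues: those `k` with `E_ρ(-λ_k ξ₀ ^ ρ) = α`. -/
def criticalSet (lam : ℕ → ℝ) (ρ α ξ₀ : ℝ) : Set ℕ :=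
  {k | mlB ρ (lam k) ξ₀ = α}

/-- The pair `(u, f)` solves the inverse source problem: `u ∈ C([0,T]; H)`, `f ∈ H`,
`D_t^ρ u, A u ∈ C((0,T]; H)`, `D_t^ρ u + A u = f` on `(0,T]`, `u(ξ₀) = α u(0) + φ`
and `u(ξ₁) = V`. Only the values of `u` on `[0,T]` matter. -/
structure IsInverseSolution {𝕜 H : Type*} [RCLike 𝕜] [NormedAddCommGroup H]
    [InnerProductSpace 𝕜 H] [NormedSpace ℝ H] (A : H →ₗ.[𝕜] H)
    (ρ α T ξ₀ ξ₁ : ℝ) (φ V : H) (u : ℝ → H) (f : H) : Prop where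
  continuousOn : ContinuousOn u (Icc 0 T)
  caputo_exists : ∀ t ∈ Ioc 0 T, CaputoExistsAt ρ u t
  caputo_continuousOn : ContinuousOn (caputoDeriv ρ u) (Ioc 0 T)
  mem_domain : ∀ t ∈ Ioc 0 T, u t ∈ A.domain
  continuous_apply : Continuous fun t : Ioc 0 T => A ⟨u t, mem_domain t t.2⟩
  equation : ∀ t (ht : t ∈ Ioc 0 T), caputoDeriv ρ u t + A ⟨u t, mem_domain t ht⟩ = f
  nonlocal : u ξ₀ = α • u 0 + φ
  overdetermination : u ξ₁ = V

/-!
In the eigenbasis the problem splits into scalar ones: the `k`-th coefficient of a solution solves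
`D_t^ρ y + λ_k y = f_k`, so it is `y = y(0) b_k + f_k a_k`, and the two conditions at `ξ₀` and `ξ₁`
are a linear system for `(y(0), f_k)` whose determinant is `-c_k`. The work lies in the properties
of the scalar solutions and in the control of the sum over `k`.

*The functions `a` and `b`.* The Mittag-Leffler series can be integrated termwise against
`(t - s) ^ (c - 1)` by the Beta integral (`intervalIntegrable_and_integral_mittagLeffler`). Applied
to `p(t) = λ t ^ (ρ - 1) E_{ρ,ρ}(-λ t ^ ρ)` (`relaxationRate`), this one formula with `c = 1`,
`c = 1 - ρ` and `c = ρ` gives `b' = -p`, the equation `D_t^ρ b = -λ b`, and the Volterra equation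
`p = (λ / Γ(ρ)) (t ^ (ρ - 1) - ∫_0^t (t - s) ^ (ρ - 1) p(s) ds)`. The log-convexity of the kernel
forces `p > 0` (`relaxationRate_pos`). Hence `b` is strictly decreasing, `b > 0` because `λ b` is a
fractional integral of `p`, `a = (1 - b) / λ` is strictly increasing, and `c_k > α a_k(ξ₁) > 0`.
The Volterra equation also yields the bound `p ≤ λ t ^ (ρ - 1) / Γ(ρ)`, uniform in `k` after
division by `λ`.

*Uniqueness.* The Caputo derivative is nonnegative at a point where the function attains its maximum
over the past (`integral_nonneg_of_isMax`), so `D_t^ρ z = -λ z`, `z(0) = 0` has only the zero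
solution. This determines each coefficient of a solution (`IsInverseSolution.inner_eq`).

*Existence.* Since `c_k λ_k` is bounded below and `φ, V ∈ D(A)`, Cramer's rule yields a source
`f ∈ H` and an initial value in `D(A)`. Then `u` and its derivative are diagonal operators with
bounded multipliers applied to fixed vectors (`relaxation`), and dominated convergence
(`tendsto_diagonalOp`) together with the bound on `p` gives the required regularity.
-/

/-! ### The Beta integral -/

theorem integral_rpow_mul_sub_rpow {a b t : ℝ} (ha : 0 < a) (hb : 0 < b) (ht : 0 < t) :
    ∫ s in (0 : ℝ)..t, (t - s) ^ (a - 1) * s ^ (b - 1) =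
      t ^ (a + b - 1) * (Real.Gamma a * Real.Gamma b / Real.Gamma (a + b)) := by
  have h := Complex.betaIntegral_scaled (b : ℂ) (a : ℂ) ht
  rw [Complex.betaIntegral_eq_Gamma_mul_div _ _ (by simpa) (by simpa)] at h
  have h2 : ∫ x in (0 : ℝ)..t, (x : ℂ) ^ ((b : ℂ) - 1) * ((t : ℂ) - x) ^ ((a : ℂ) - 1) =
      ((∫ s in (0 : ℝ)..t, (t - s) ^ (a - 1) * s ^ (b - 1) : ℝ) : ℂ) := by
    rw [← intervalIntegral.integral_ofReal]
    refine intervalIntegral.integral_congr fun x hx => ?_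
    rw [uIcc_of_le ht.le] at hx
    rw [Complex.ofReal_mul, Complex.ofReal_cpow hx.1, Complex.ofReal_cpow (sub_nonneg.2 hx.2)]
    push_cast
    ring
  rw [h2, ← Complex.ofReal_add, Complex.Gamma_ofReal, Complex.Gamma_ofReal, Complex.Gamma_ofReal,
    show (((b + a : ℝ) : ℂ) - 1) = ((a + b - 1 : ℝ) : ℂ) by push_cast; ring,
    ← Complex.ofReal_cpow ht.le] at h
  rw [add_comm b a, mul_comm (Real.Gamma b : ℂ)] at h
  exact_mod_cast h

/-- The Beta integrand is integrable because its integral, which would otherwise be the junk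
value `0`, is nonzero. -/
theorem intervalIntegrable_rpow_mul_sub_rpow {a b t : ℝ} (ha : 0 < a) (hb : 0 < b) (ht : 0 < t) :
    IntervalIntegrable (fun s => (t - s) ^ (a - 1) * s ^ (b - 1)) volume 0 t := by
  by_contra h
  have h1 := integral_rpow_mul_sub_rpow ha hb ht
  rw [intervalIntegral.integral_undef h] at h1
  have := Real.Gamma_pos_of_pos ha
  have := Real.Gamma_pos_of_pos hb
  have := Real.Gamma_pos_of_pos (add_pos ha hb)
  have : 0 < t ^ (a + b - 1) * (Real.Gamma a * Real.Gamma b / Real.Gamma (a + b)) := by positivity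
  linarith

/-! ### The Mittag-Leffler function -/

/-- Log-convexity of the Gamma function bounds the ratio of consecutive coefficients of the
Mittag-Leffler series. -/
theorem Gamma_div_Gamma_add_le {ρ x : ℝ} (hρ : ρ ∈ Ioo (0 : ℝ) 1) (hx : 0 < x) :
    Real.Gamma x / Real.Gamma (x + ρ) ≤ (x + ρ) ^ (1 - ρ) / x := by
  have hxρ : 0 < x + ρ := add_pos hx hρ.1
  have hG := Real.Gamma_pos_of_pos hxρ
  have h := Real.Gamma_mul_add_mul_le_rpow_Gamma_mul_rpow_Gamma hxρ (by linarith : 0 < x + ρ + 1)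
    hρ.1 (sub_pos.2 hρ.2) (by ring)
  rw [show ρ * (x + ρ) + (1 - ρ) * (x + ρ + 1) = x + 1 by ring, Real.Gamma_add_one hx.ne',
    Real.Gamma_add_one hxρ.ne', Real.mul_rpow hxρ.le hG.le, mul_left_comm,
    ← Real.rpow_add hG] at h
  simp only [add_sub_cancel, Real.rpow_one] at h
  rw [div_le_div_iff₀ hG hx, mul_comm]
  exact h

theorem tendsto_Gamma_div_Gamma_add {ρ : ℝ} (hρ : ρ ∈ Ioo (0 : ℝ) 1) :
    Tendsto (fun x => Real.Gamma x / Real.Gamma (x + ρ)) atTop (nhds 0) := by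
  have hlim : Tendsto (fun x : ℝ => 2 * x ^ (-ρ)) atTop (nhds 0) := by
    simpa using (tendsto_rpow_neg_atTop hρ.1).const_mul 2
  refine squeeze_zero' ?_ ?_ hlim
  · filter_upwards [eventually_gt_atTop 0] with x hx
    exact div_nonneg (Real.Gamma_pos_of_pos hx).le (Real.Gamma_pos_of_pos (add_pos hx hρ.1)).le
  · filter_upwards [eventually_ge_atTop 1] with x hx
    have hx0 : 0 < x := by linarith
    refine (Gamma_div_Gamma_add_le hρ hx0).trans ?_
    have h1 : (x + ρ) ^ (1 - ρ) ≤ (2 * x) ^ (1 - ρ) :=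
      Real.rpow_le_rpow (by linarith [hρ.1]) (by linarith [hρ.2]) (by linarith [hρ.2])
    have h2 : (2 : ℝ) ^ (1 - ρ) ≤ 2 := by
      simpa using Real.rpow_le_rpow_of_exponent_le (x := 2) one_le_two (by linarith [hρ.1] : 1 - ρ ≤ 1)
    rw [Real.mul_rpow two_pos.le hx0.le] at h1
    rw [div_le_iff₀ hx0]
    calc _ ≤ _ := h1
      _ ≤ 2 * x ^ (1 - ρ) := by gcongr
      _ = 2 * x ^ (-ρ) * x := by
        rw [mul_assoc, ← Real.rpow_add_one hx0.ne', neg_add_eq_sub]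

theorem summable_mittagLeffler {ρ μ : ℝ} (hρ : ρ ∈ Ioo (0 : ℝ) 1) (hμ : 0 < μ) (z : ℝ) :
    Summable fun n : ℕ => z ^ n / Real.Gamma (ρ * n + μ) := by
  rcases eq_or_ne z 0 with rfl | hz
  · refine summable_of_ne_finset_zero (s := {0}) fun n hn => ?_
    simp [zero_pow (by simpa using hn : n ≠ 0)]
  have hpos : ∀ n : ℕ, 0 < ρ * n + μ := fun n => by have := hρ.1; positivity
  refine summable_of_ratio_test_tendsto_lt_one zero_lt_one (Eventually.of_forall fun n => ?_) ?_
  · exact div_ne_zero (pow_ne_zero _ hz) (Real.Gamma_pos_of_pos (hpos n)).ne'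
  · have hx : Tendsto (fun n : ℕ => ρ * (n : ℝ) + μ) atTop atTop :=
      tendsto_atTop_add_const_right _ _
        (tendsto_natCast_atTop_atTop.const_mul_atTop hρ.1)
    have := ((tendsto_Gamma_div_Gamma_add hρ).comp hx).const_mul |z|
    rw [mul_zero] at this
    refine this.congr fun n => ?_
    have e : ρ * ((n + 1 : ℕ) : ℝ) + μ = ρ * n + μ + ρ := by push_cast; ring
    have h1 := Real.Gamma_pos_of_pos (hpos n)
    have h2 := Real.Gamma_pos_of_pos (hpos (n + 1))
    rw [e] at h2
    simp only [Function.comp, Real.norm_eq_abs, abs_div, abs_pow, e, abs_of_pos h1, abs_of_pos h2]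
    have := abs_pos.2 hz
    rw [pow_succ']
    field_simp

theorem mittagLeffler_eq_add {ρ μ : ℝ} (hρ : ρ ∈ Ioo (0 : ℝ) 1) (hμ : 0 < μ) (z : ℝ) :
    mittagLeffler ρ μ z = 1 / Real.Gamma μ + z * mittagLeffler ρ (μ + ρ) z := by
  rw [mittagLeffler, (summable_mittagLeffler hρ hμ z).tsum_eq_zero_add, mittagLeffler,
    ← tsum_mul_left]
  congr 1
  · simp
  · refine tsum_congr fun n => ?_
    rw [show ρ * ((n + 1 : ℕ) : ℝ) + μ = ρ * n + (μ + ρ) by push_cast; ring]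
    ring

theorem continuous_mittagLeffler {ρ μ : ℝ} (hρ : ρ ∈ Ioo (0 : ℝ) 1) (hμ : 0 < μ) :
    Continuous (mittagLeffler ρ μ) := by
  rw [continuous_iff_continuousAt]
  intro z
  have hpos : ∀ n : ℕ, 0 < ρ * n + μ := fun n => by have := hρ.1; positivity
  have : ContinuousOn (mittagLeffler ρ μ) (Icc (-(|z| + 1)) (|z| + 1)) := by
    refine continuousOn_tsum (fun n => by fun_prop) (summable_mittagLeffler hρ hμ (|z| + 1)) ?_
    intro n x hx
    rw [norm_div, norm_pow, Real.norm_eq_abs, Real.norm_eq_abs,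
      abs_of_pos (Real.Gamma_pos_of_pos (hpos n))]
    have := Real.Gamma_pos_of_pos (hpos n)
    have := abs_le.2 hx
    gcongr
  refine this.continuousAt (Icc_mem_nhds ?_ ?_)
  · linarith [neg_abs_le z]
  · linarith [le_abs_self z]

/-- Fractional integration of order `c` maps `s ^ (μ - 1) E_{ρ,μ}(z s ^ ρ)` to
`t ^ (μ + c - 1) E_{ρ,μ+c}(z t ^ ρ)`: integrate the series termwise with the Beta integral. -/
theorem intervalIntegrable_and_integral_mittagLeffler {ρ μ c t : ℝ} (hρ : ρ ∈ Ioo (0 : ℝ) 1)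
    (hμ : 0 < μ) (hc : 0 < c) (ht : 0 < t) (z : ℝ) :
    IntervalIntegrable
      (fun s => (t - s) ^ (c - 1) * (s ^ (μ - 1) * mittagLeffler ρ μ (z * s ^ ρ))) volume 0 t ∧
    ∫ s in (0 : ℝ)..t, (t - s) ^ (c - 1) * (s ^ (μ - 1) * mittagLeffler ρ μ (z * s ^ ρ)) =
      Real.Gamma c * (t ^ (μ + c - 1) * mittagLeffler ρ (μ + c) (z * t ^ ρ)) := by
  have hρ0 := hρ.1
  have hpos : ∀ n : ℕ, 0 < ρ * n + μ := fun n => by positivity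
  have hsub : IntervalIntegrable
      (fun s => (t - s) ^ (c - 1) * (s ^ (μ - 1) * mittagLeffler ρ μ (z * s ^ ρ))) volume 0 t := by
    have h := (intervalIntegrable_rpow_mul_sub_rpow hc hμ ht).mul_continuousOn
      (g := fun s => mittagLeffler ρ μ (z * s ^ ρ)) (by
        refine (continuous_mittagLeffler hρ hμ).comp_continuousOn ?_
        exact (continuous_const.mul (Real.continuous_rpow_const hρ.1.le)).continuousOn)
    simpa only [mul_assoc] using h
  refine ⟨hsub, ?_⟩
  set F : ℕ → ℝ → ℝ := fun n s =>
    z ^ n / Real.Gamma (ρ * n + μ) * ((t - s) ^ (c - 1) * s ^ (ρ * n + μ - 1)) with hF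
  have hint : ∀ n, IntervalIntegrable (F n) volume 0 t := fun n =>
    (intervalIntegrable_rpow_mul_sub_rpow hc (hpos n) ht).const_mul _
  have hval : ∀ n : ℕ, ∫ s in (0 : ℝ)..t, (t - s) ^ (c - 1) * s ^ (ρ * n + μ - 1) =
      Real.Gamma c * t ^ (μ + c - 1) * (t ^ ρ) ^ n *
        (Real.Gamma (ρ * n + μ) / Real.Gamma (ρ * n + (μ + c))) := fun n => by
    rw [integral_rpow_mul_sub_rpow hc (hpos n) ht,
      show c + (ρ * n + μ) - 1 = (μ + c - 1) + ρ * n by ring, Real.rpow_add ht,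
      Real.rpow_mul ht.le, Real.rpow_natCast, show c + (ρ * n + μ) = ρ * n + (μ + c) by ring]
    ring
  have hFval : ∀ n, ∫ s in (0 : ℝ)..t, F n s =
      Real.Gamma c * t ^ (μ + c - 1) *
        ((z * t ^ ρ) ^ n / Real.Gamma (ρ * n + (μ + c))) := fun n => by
    simp only [hF]
    rw [intervalIntegral.integral_const_mul, hval, mul_pow]
    have := (Real.Gamma_pos_of_pos (hpos n)).ne'
    field_simp
  have hFnorm : ∀ n, ∫ s in (0 : ℝ)..t, ‖F n s‖ =
      Real.Gamma c * t ^ (μ + c - 1) *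
        ((|z| * t ^ ρ) ^ n / Real.Gamma (ρ * n + (μ + c))) := fun n => by
    have hG := Real.Gamma_pos_of_pos (hpos n)
    have : ∫ s in (0 : ℝ)..t, ‖F n s‖ = ∫ s in (0 : ℝ)..t,
        |z| ^ n / Real.Gamma (ρ * n + μ) * ((t - s) ^ (c - 1) * s ^ (ρ * n + μ - 1)) := by
      refine intervalIntegral.integral_congr fun s hs => ?_
      rw [uIcc_of_le ht.le] at hs
      simp only [hF, Real.norm_eq_abs, abs_mul, abs_div, abs_pow, abs_of_pos hG,
        abs_of_nonneg (Real.rpow_nonneg hs.1 _), abs_of_nonneg (Real.rpow_nonneg (sub_nonneg.2 hs.2) _)]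
    rw [this, intervalIntegral.integral_const_mul, hval, mul_pow]
    have := hG.ne'
    field_simp
  have hS : HasSum (fun n => ∫ s in (0 : ℝ)..t, F n s)
      (∫ s in (0 : ℝ)..t, ∑' n, F n s) := by
    simp only [intervalIntegral.integral_of_le ht.le]
    refine hasSum_integral_of_summable_integral_norm
      (fun n => (intervalIntegrable_iff_integrableOn_Ioc_of_le ht.le).1 (hint n)) ?_
    simp only [← intervalIntegral.integral_of_le ht.le, hFnorm]
    exact (summable_mittagLeffler hρ (add_pos hμ hc) _).mul_left _
  have hsum : ∫ s in (0 : ℝ)..t, (t - s) ^ (c - 1) * (s ^ (μ - 1) * mittagLeffler ρ μ (z * s ^ ρ)) =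
      ∫ s in (0 : ℝ)..t, ∑' n, F n s := by
    refine intervalIntegral.integral_congr_ae (Eventually.of_forall fun s hs => ?_)
    rw [uIoc_of_le ht.le] at hs
    rw [mittagLeffler, ← tsum_mul_left, ← tsum_mul_left]
    refine tsum_congr fun n => ?_
    simp only [hF]
    rw [show ρ * n + μ - 1 = (μ - 1) + ρ * n by ring, Real.rpow_add hs.1,
      Real.rpow_mul hs.1.le, Real.rpow_natCast, mul_pow]
    ring
  rw [hsum, ← hS.tsum_eq]
  simp only [hFval]
  rw [tsum_mul_left, mul_assoc, mittagLeffler]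

/-! ### The relaxation function and its rate of decay -/

/-- The rate of decay `p(t) = l t ^ (ρ - 1) E_{ρ,ρ}(-l t ^ ρ)` of the relaxation function
`b(t) = E_ρ(-l t ^ ρ)`; on `t > 0` it is `-b'(t)`. -/
noncomputable def relaxationRate (ρ l t : ℝ) : ℝ :=
  l * (t ^ (ρ - 1) * mittagLeffler ρ ρ (-l * t ^ ρ))

section Relaxation

variable {ρ : ℝ} (hρ : ρ ∈ Ioo (0 : ℝ) 1)
include hρ

theorem continuousOn_relaxationRate (l : ℝ) : ContinuousOn (relaxationRate ρ l) (Ioi 0) := by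
  have h1 : Continuous fun t : ℝ => mittagLeffler ρ ρ (-l * t ^ ρ) :=
    (continuous_mittagLeffler hρ hρ.1).comp
      (continuous_const.mul (Real.continuous_rpow_const hρ.1.le))
  have h2 : ContinuousOn (fun t : ℝ => t ^ (ρ - 1)) (Ioi 0) :=
    continuousOn_id.rpow_const fun t ht => Or.inl (ne_of_gt ht)
  exact continuousOn_const.mul (h2.mul h1.continuousOn)

theorem mlB_eq_one_sub (l t : ℝ) : mlB ρ l t = 1 - l * mlA ρ l t := by
  rw [mlB, mittagLeffler_eq_add hρ one_pos, mlA, Real.Gamma_one, add_comm 1 ρ]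
  ring

theorem intervalIntegrable_rpow_mul_relaxationRate (l : ℝ) {c t : ℝ} (hc : 0 < c) (ht : 0 < t) :
    IntervalIntegrable (fun s => (t - s) ^ (c - 1) * relaxationRate ρ l s) volume 0 t := by
  refine ((intervalIntegrable_and_integral_mittagLeffler hρ hρ.1 hc ht (-l)).1.const_mul l).congr ?_
  intro s _
  simp only [relaxationRate]
  ring

theorem integral_rpow_mul_relaxationRate (l : ℝ) {c t : ℝ} (hc : 0 < c) (ht : 0 < t) :
    ∫ s in (0 : ℝ)..t, (t - s) ^ (c - 1) * relaxationRate ρ l s =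
      l * (Real.Gamma c * (t ^ (ρ + c - 1) * mittagLeffler ρ (ρ + c) (-l * t ^ ρ))) := by
  rw [← (intervalIntegrable_and_integral_mittagLeffler hρ hρ.1 hc ht (-l)).2,
    ← intervalIntegral.integral_const_mul]
  refine intervalIntegral.integral_congr fun s _ => ?_
  rw [relaxationRate]
  ring

theorem intervalIntegrable_relaxationRate (l : ℝ) {t : ℝ} (ht : 0 < t) :
    IntervalIntegrable (relaxationRate ρ l) volume 0 t := by
  simpa using intervalIntegrable_rpow_mul_relaxationRate hρ l one_pos ht

theorem integral_relaxationRate (l : ℝ) {t : ℝ} (ht : 0 < t) :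
    ∫ s in (0 : ℝ)..t, relaxationRate ρ l s = 1 - mlB ρ l t := by
  have h := integral_rpow_mul_relaxationRate hρ l one_pos ht
  simp only [sub_self, Real.rpow_zero, one_mul, Real.Gamma_one, add_sub_cancel_right] at h
  rw [h, mlB_eq_one_sub hρ, mlA]
  ring

/-- The fractional integral behind the equation `D_t^ρ b = -l b`. -/
theorem integral_rpow_neg_mul_relaxationRate (l : ℝ) {t : ℝ} (ht : 0 < t) :
    ∫ s in (0 : ℝ)..t, (t - s) ^ (-ρ) * relaxationRate ρ l s =
      Real.Gamma (1 - ρ) * (l * mlB ρ l t) := by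
  have h := integral_rpow_mul_relaxationRate hρ l (sub_pos.2 hρ.2) ht
  simp only [add_sub_cancel, sub_self, Real.rpow_zero, one_mul,
    show (1 : ℝ) - ρ - 1 = -ρ by ring] at h
  rw [h, mlB]
  ring

/-- The rate is the resolvent of the Abel kernel: it solves a Volterra equation of the second
kind. -/
theorem relaxationRate_eq (l : ℝ) {t : ℝ} (ht : 0 < t) :
    relaxationRate ρ l t = l / Real.Gamma ρ *
      (t ^ (ρ - 1) - ∫ s in (0 : ℝ)..t, (t - s) ^ (ρ - 1) * relaxationRate ρ l s) := by
  rw [integral_rpow_mul_relaxationRate hρ l hρ.1 ht, relaxationRate,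
    mittagLeffler_eq_add hρ hρ.1, show ρ + ρ - 1 = (ρ - 1) + ρ by ring, Real.rpow_add ht]
  have := (Real.Gamma_pos_of_pos hρ.1).ne'
  field_simp
  ring

/-- The resolvent of the Abel kernel is positive. At a first zero `t₀`, log-convexity of the
kernel compares the Volterra equations at `t₀` and at a point `t < t₀` where the rate is maximal
on `[t, t₀]`; the comparison bounds `1` by a multiple of `(t₀ - t) ^ ρ`, which is absurd for `t`
near `t₀`. -/
theorem relaxationRate_pos {l t : ℝ} (hl : 0 < l) (ht : 0 < t) : 0 < relaxationRate ρ l t := by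
  by_contra hcon
  have hG := Real.Gamma_pos_of_pos hρ.1
  have hρ0 := hρ.1
  set q : ℝ → ℝ := fun t => mittagLeffler ρ ρ (-l * t ^ ρ) with hq
  have hqc : Continuous q := (continuous_mittagLeffler hρ hρ.1).comp
      (continuous_const.mul (Real.continuous_rpow_const hρ.1.le))
  have hsign : ∀ {s : ℝ}, 0 < s → (0 < relaxationRate ρ l s ↔ 0 < q s) := fun {s} hs => by
    rw [relaxationRate, mul_pos_iff_of_pos_left hl,
      mul_pos_iff_of_pos_left (Real.rpow_pos_of_pos hs _)]
  have hq0 : 0 < q 0 := by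
    simp only [hq, Real.zero_rpow hρ.1.ne', mul_zero]
    rw [mittagLeffler_eq_add hρ hρ.1, zero_mul, add_zero]
    positivity
  set S : Set ℝ := Ici 0 ∩ {s | q s ≤ 0} with hS
  have hScl : IsClosed S := isClosed_Ici.inter (isClosed_le hqc continuous_const)
  have htS : t ∈ S := ⟨ht.le, not_lt.1 fun h => hcon ((hsign ht).2 h)⟩
  have hbdd : BddBelow S := ⟨0, fun s hs => hs.1⟩
  obtain ⟨ht00, ht0q⟩ := hScl.csInf_mem ⟨t, htS⟩ hbdd
  set t₀ := sInf S with ht₀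
  have ht0 : 0 < t₀ := lt_of_le_of_ne ht00 fun h => by
    rw [← h] at ht0q; exact absurd hq0 (not_lt.2 ht0q)
  have hbefore : ∀ s, 0 < s → s < t₀ → 0 < relaxationRate ρ l s := fun s hs hst =>
    (hsign hs).2 (not_le.1 fun h => absurd (csInf_le hbdd ⟨hs.le, h⟩) (not_le.2 hst))
  have hp0 : relaxationRate ρ l t₀ ≤ 0 :=
    not_lt.1 fun h => absurd ((hsign ht0).1 h) (not_lt.2 ht0q)
  -- a left neighbour of `t₀` beyond which `(t₀ - x) ^ ρ` is small
  obtain ⟨t', ht'1, ht'2, ht'3⟩ : ∃ x, t₀ / 2 < x ∧ x < t₀ ∧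
      (t₀ - x) ^ ρ / ρ < Real.Gamma ρ / (2 * l) := by
    have hlim : ContinuousAt (fun x : ℝ => (t₀ - x) ^ ρ / ρ) t₀ :=
      (((Real.continuous_rpow_const hρ.1.le).comp
        (continuous_const.sub continuous_id)).div_const ρ).continuousAt
    have h1 : ∀ᶠ x in nhds t₀, (t₀ - x) ^ ρ / ρ < Real.Gamma ρ / (2 * l) := by
      refine hlim.eventually_lt_const ?_
      simp only [sub_self, Real.zero_rpow hρ.1.ne', zero_div]
      positivity
    have h2 : ∀ᶠ x in nhds t₀, t₀ / 2 < x := lt_mem_nhds (by linarith)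
    obtain ⟨x, ⟨hx1, hx2⟩, hx3⟩ :=
      (((h1.and h2).filter_mono nhdsWithin_le_nhds).and
        (self_mem_nhdsWithin : Iio t₀ ∈ nhdsWithin t₀ (Iio t₀))).exists
    exact ⟨x, hx2, hx3, hx1⟩
  have ht'0 : 0 < t' := by linarith
  obtain ⟨τ, hτ, hmax⟩ := isCompact_Icc.exists_isMaxOn (nonempty_Icc.2 ht'2.le)
    ((continuousOn_relaxationRate hρ l).mono fun x hx => ht'0.trans_le hx.1)
  have hpτ : 0 < relaxationRate ρ l τ :=
    (hbefore t' ht'0 ht'2).trans_le (hmax (left_mem_Icc.2 ht'2.le))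
  have hτ0 : 0 < τ := ht'0.trans_le hτ.1
  have hτt : τ < t₀ := lt_of_le_of_ne hτ.2 fun h => by rw [h] at hpτ; linarith
  have hint := intervalIntegrable_rpow_mul_relaxationRate hρ l hρ.1 ht0
  have hint1 : IntervalIntegrable (fun s => (t₀ - s) ^ (ρ - 1) * relaxationRate ρ l s)
      volume 0 τ := hint.mono_set (by
    rw [uIcc_of_le hτ0.le, uIcc_of_le ht0.le]; exact Icc_subset_Icc_right hτ.2)
  have hint2 : IntervalIntegrable (fun s => (t₀ - s) ^ (ρ - 1) * relaxationRate ρ l s)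
      volume τ t₀ := hint.mono_set (by
    rw [uIcc_of_le hτt.le, uIcc_of_le ht0.le]; exact Icc_subset_Icc_left hτ0.le)
  have hsplit := intervalIntegral.integral_add_adjacent_intervals hint1 hint2
  set r : ℝ := t₀ ^ (ρ - 1) / τ ^ (ρ - 1) with hr
  have hkτ := Real.rpow_pos_of_pos hτ0 (ρ - 1)
  have hfirst : ∫ s in (0 : ℝ)..τ, (t₀ - s) ^ (ρ - 1) * relaxationRate ρ l s ≤
      r * ∫ s in (0 : ℝ)..τ, (τ - s) ^ (ρ - 1) * relaxationRate ρ l s := by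
    rw [← intervalIntegral.integral_const_mul]
    refine intervalIntegral.integral_mono_on_of_le_Ioo hτ0.le hint1
      ((intervalIntegrable_rpow_mul_relaxationRate hρ l hρ.1 hτ0).const_mul r) fun s hs => ?_
    rw [← mul_assoc]
    refine mul_le_mul_of_nonneg_right ?_ (hbefore s hs.1 (hs.2.trans hτt)).le
    rw [hr, div_mul_eq_mul_div, le_div_iff₀ hkτ,
      ← Real.mul_rpow (by linarith [hs.2]) hτ0.le,
      ← Real.mul_rpow ht0.le (by linarith [hs.2])]
    refine Real.rpow_le_rpow_of_nonpos (mul_pos ht0 (by linarith [hs.2])) ?_ (by linarith [hρ.2])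
    nlinarith [hs.1, hs.2]
  have hkint : IntervalIntegrable (fun s => (t₀ - s) ^ (ρ - 1)) volume τ t₀ := by
    have := (intervalIntegral.intervalIntegrable_rpow' (a := t₀ - τ) (b := t₀ - t₀)
      (by linarith : -1 < ρ - 1)).comp_sub_left t₀
    simpa using this
  have hkval : ∫ s in τ..t₀, (t₀ - s) ^ (ρ - 1) = (t₀ - τ) ^ ρ / ρ := by
    rw [intervalIntegral.integral_comp_sub_left (fun x => x ^ (ρ - 1)),
      integral_rpow (Or.inl (by linarith))]
    simp [Real.zero_rpow hρ.1.ne']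
  have hsecond : ∫ s in τ..t₀, (t₀ - s) ^ (ρ - 1) * relaxationRate ρ l s ≤
      (t₀ - τ) ^ ρ / ρ * relaxationRate ρ l τ := by
    rw [← hkval, ← intervalIntegral.integral_mul_const]
    refine intervalIntegral.integral_mono_on hτt.le hint2 (hkint.mul_const _) fun s hs => ?_
    exact mul_le_mul_of_nonneg_left (hmax ⟨hτ.1.trans hs.1, hs.2⟩)
      (Real.rpow_nonneg (sub_nonneg.2 hs.2) _)
  have hV0 := relaxationRate_eq hρ l ht0
  have hVτ := relaxationRate_eq hρ l hτ0
  rw [hV0] at hp0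
  set J := ∫ s in (0 : ℝ)..τ, (τ - s) ^ (ρ - 1) * relaxationRate ρ l s with hJ
  have hJτ : J = τ ^ (ρ - 1) - Real.Gamma ρ / l * relaxationRate ρ l τ := by
    rw [hVτ]; field_simp; ring
  have hp0' : t₀ ^ (ρ - 1) ≤ ∫ s in (0 : ℝ)..t₀, (t₀ - s) ^ (ρ - 1) * relaxationRate ρ l s := by
    have : 0 < l / Real.Gamma ρ := by positivity
    by_contra h
    push Not at h
    exact absurd hp0 (not_le.2 (mul_pos this (by linarith)))
  have hrr : 1 / 2 ≤ r := by
    have h1 : r = (τ / t₀) ^ (1 - ρ) := by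
      rw [hr, Real.div_rpow hτ0.le ht0.le, show ρ - 1 = -(1 - ρ) by ring,
        Real.rpow_neg ht0.le, Real.rpow_neg hτ0.le]
      field_simp
    have h2 : (1 : ℝ) / 2 ≤ τ / t₀ := by rw [le_div_iff₀ ht0]; linarith [hτ.1]
    have h3 : τ / t₀ ≤ 1 := (div_le_one ht0).2 hτ.2
    have h4 := Real.rpow_le_rpow_of_exponent_ge (by positivity : 0 < τ / t₀) h3
      (by linarith : 1 - ρ ≤ 1)
    rw [Real.rpow_one] at h4
    rw [h1]; exact h2.trans h4
  have hrk : r * τ ^ (ρ - 1) = t₀ ^ (ρ - 1) := div_mul_cancel₀ _ hkτ.ne'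
  have hsmall : (t₀ - τ) ^ ρ / ρ ≤ (t₀ - t') ^ ρ / ρ :=
    div_le_div_of_nonneg_right (Real.rpow_le_rpow (by linarith) (by linarith [hτ.1]) hρ.1.le) hρ.1.le
  have key : r * (Real.Gamma ρ / l) * relaxationRate ρ l τ ≤
      (t₀ - τ) ^ ρ / ρ * relaxationRate ρ l τ := by
    rw [hJτ, mul_sub, hrk, ← mul_assoc] at hfirst
    linarith
  have key2 := le_of_mul_le_mul_right key hpτ
  have : 1 / 2 * (Real.Gamma ρ / l) ≤ r * (Real.Gamma ρ / l) :=
    mul_le_mul_of_nonneg_right hrr (by positivity)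
  rw [show 1 / 2 * (Real.Gamma ρ / l) = Real.Gamma ρ / (2 * l) by field_simp] at this
  linarith

theorem relaxationRate_le {l t : ℝ} (hl : 0 < l) (ht : 0 < t) :
    relaxationRate ρ l t ≤ l * (t ^ (ρ - 1) / Real.Gamma ρ) := by
  have hG := Real.Gamma_pos_of_pos hρ.1
  have h0 : 0 ≤ ∫ s in (0 : ℝ)..t, (t - s) ^ (ρ - 1) * relaxationRate ρ l s := by
    rw [intervalIntegral.integral_of_le ht.le]
    refine setIntegral_nonneg measurableSet_Ioc fun s hs => ?_
    exact mul_nonneg (Real.rpow_nonneg (sub_nonneg.2 hs.2) _) (relaxationRate_pos hρ hl hs.1).le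
  rw [relaxationRate_eq hρ l ht]
  calc _ ≤ l / Real.Gamma ρ * t ^ (ρ - 1) := by gcongr; linarith
    _ = _ := by ring

theorem continuous_mlB (l : ℝ) : Continuous (mlB ρ l) :=
  (continuous_mittagLeffler hρ one_pos).comp
    (continuous_const.mul (Real.continuous_rpow_const hρ.1.le))

theorem mlA_zero (l : ℝ) : mlA ρ l 0 = 0 := by
  rw [mlA, Real.zero_rpow hρ.1.ne', zero_mul]

theorem mlB_zero (l : ℝ) : mlB ρ l 0 = 1 := by
  rw [mlB_eq_one_sub hρ, mlA_zero hρ]; ring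

theorem hasDerivAt_mlB (l : ℝ) {t : ℝ} (ht : 0 < t) :
    HasDerivAt (mlB ρ l) (-relaxationRate ρ l t) t := by
  have hc := continuousOn_relaxationRate hρ l
  have h := intervalIntegral.integral_hasDerivAt_right
    (intervalIntegrable_relaxationRate hρ l ht)
    (hc.stronglyMeasurableAtFilter isOpen_Ioi t ht) (hc.continuousAt (Ioi_mem_nhds ht))
  refine (h.const_sub 1).congr_of_eventuallyEq ?_
  filter_upwards [Ioi_mem_nhds ht] with s hs
  rw [integral_relaxationRate hρ l hs]
  ring

theorem mlB_strictAntiOn {l : ℝ} (hl : 0 < l) : StrictAntiOn (mlB ρ l) (Ici 0) := by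
  refine strictAntiOn_of_deriv_neg (convex_Ici 0) (continuous_mlB hρ l).continuousOn fun t ht => ?_
  rw [interior_Ici] at ht
  rw [(hasDerivAt_mlB hρ l ht).deriv]
  exact neg_neg_of_pos (relaxationRate_pos hρ hl ht)

theorem mlB_pos {l t : ℝ} (hl : 0 < l) (ht : 0 ≤ t) : 0 < mlB ρ l t := by
  rcases ht.eq_or_lt with rfl | ht
  · rw [mlB_zero hρ]; exact one_pos
  have h : 0 < ∫ s in (0 : ℝ)..t, (t - s) ^ (-ρ) * relaxationRate ρ l s := by
    refine intervalIntegral.intervalIntegral_pos_of_pos_on ?_ (fun s hs => ?_) ht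
    · have := intervalIntegrable_rpow_mul_relaxationRate hρ l (sub_pos.2 hρ.2) ht
      simpa only [show (1 : ℝ) - ρ - 1 = -ρ by ring] using this
    · exact mul_pos (Real.rpow_pos_of_pos (sub_pos.2 hs.2) _) (relaxationRate_pos hρ hl hs.1)
  rw [integral_rpow_neg_mul_relaxationRate hρ l ht] at h
  exact pos_of_mul_pos_right (pos_of_mul_pos_right h
    (Real.Gamma_pos_of_pos (sub_pos.2 hρ.2)).le) hl.le

theorem mlB_le_one {l t : ℝ} (hl : 0 < l) (ht : 0 ≤ t) : mlB ρ l t ≤ 1 := by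
  rw [← mlB_zero hρ l]
  exact (mlB_strictAntiOn hρ hl).antitoneOn self_mem_Ici ht ht

theorem mlA_eq {l : ℝ} (hl : 0 < l) (t : ℝ) : mlA ρ l t = (1 - mlB ρ l t) / l := by
  rw [mlB_eq_one_sub hρ]; field_simp; ring

theorem mlA_strictMonoOn {l : ℝ} (hl : 0 < l) : StrictMonoOn (mlA ρ l) (Ici 0) := by
  intro s hs t ht hst
  rw [mlA_eq hρ hl, mlA_eq hρ hl]
  have := mlB_strictAntiOn hρ hl hs ht hst
  gcongr

theorem mlA_pos {l t : ℝ} (hl : 0 < l) (ht : 0 < t) : 0 < mlA ρ l t := by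
  have := mlA_strictMonoOn hρ hl self_mem_Ici ht.le ht
  rwa [mlA_zero hρ] at this

/-- By the scaling `b_l(t) = b_1(l ^ (1 / ρ) t)`, strict monotonicity in `t` gives strict
monotonicity in `l`. -/
theorem mlB_strictAntiOn_left {t : ℝ} (ht : 0 < t) :
    StrictAntiOn (fun l => mlB ρ l t) (Ici 0) := by
  have hscale : ∀ l : ℝ, 0 ≤ l → mlB ρ l t = mlB ρ 1 (l ^ (1 / ρ) * t) := fun l hl => by
    rw [mlB, mlB, Real.mul_rpow (Real.rpow_nonneg hl _) ht.le, ← Real.rpow_mul hl,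
      one_div_mul_cancel hρ.1.ne', Real.rpow_one]
    ring_nf
  intro l hl m hm hlm
  simp only
  rw [hscale l hl, hscale m hm]
  refine mlB_strictAntiOn hρ one_pos (mul_nonneg (Real.rpow_nonneg hl _) ht.le)
    (mul_nonneg (Real.rpow_nonneg hm _) ht.le) ?_
  exact mul_lt_mul_of_pos_right (Real.rpow_lt_rpow hl hlm (one_div_pos.2 hρ.1)) ht

/-- Both columns of the system for the initial value and the source enter with a favourable sign:
`b(ξ₁) a(ξ₀) > a(ξ₁) b(ξ₀)`, so the determinant exceeds `α a(ξ₁)`. -/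
theorem mul_mlA_lt_determinant {l α ξ₀ ξ₁ : ℝ} (hl : 0 < l) (hξ₁ : 0 < ξ₁) (hξ : ξ₁ < ξ₀) :
    α * mlA ρ l ξ₁ < mlB ρ l ξ₁ * mlA ρ l ξ₀ + mlA ρ l ξ₁ * (α - mlB ρ l ξ₀) := by
  have h0 : (0 : ℝ) ≤ ξ₀ := (hξ₁.trans hξ).le
  have hb := mlB_strictAntiOn hρ hl hξ₁.le h0 hξ
  have ha := mlA_strictMonoOn hρ hl hξ₁.le h0 hξ
  have hb0 := mlB_pos hρ hl h0
  have ha1 := mlA_pos hρ hl hξ₁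
  nlinarith

end Relaxation

/-! ### Uniqueness for the scalar fractional equation -/

/-- The extremum principle for the Caputo derivative: it is nonnegative at the right end point of
an interval on which the function is maximal there. With `h = z t - z`, integration by parts on
`[0, r]` bounds `-∫ z' (t - s) ^ (-ρ)` by the boundary term `h(r) (t - r) ^ (-ρ)`, and that is at
most the integral of `|z'| (t - s) ^ (-ρ)` over `[r, t]`, which vanishes as `r → t`. -/
theorem integral_nonneg_of_isMax {ρ t : ℝ} {z : ℝ → ℝ} (hρ : 0 < ρ) (ht : 0 < t)
    (hz : ContinuousOn z (Icc 0 t)) (hex : CaputoExistsAt ρ z t) (hmax : ∀ s ∈ Icc 0 t, z s ≤ z t) :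
    0 ≤ ∫ s in (0 : ℝ)..t, (1 / (t - s) ^ ρ) • deriv z s := by
  obtain ⟨hd, hi⟩ := hex
  set ψ : ℝ → ℝ := fun s => (1 / (t - s) ^ ρ) • deriv z s with hψ
  have hiI : IntegrableOn ψ (Icc 0 t) :=
    (intervalIntegrable_iff_integrableOn_Icc_of_le ht.le).1 hi
  have hw : ∀ s < t, HasDerivAt (fun s : ℝ => (t - s) ^ (-ρ)) (ρ * (t - s) ^ (-ρ - 1)) s :=
    fun s hs => by
      have h1 : HasDerivAt (fun s : ℝ => t - s) (-1) s := by
        simpa using (hasDerivAt_id s).const_sub t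
      have := h1.rpow_const (p := -ρ) (Or.inl (sub_pos.2 hs).ne')
      convert this using 1
      ring
  have hinv : ∀ s < t, 1 / (t - s) ^ ρ = (t - s) ^ (-ρ) := fun s hs => by
    rw [Real.rpow_neg (sub_pos.2 hs).le, one_div]
  have hbound : ∀ r ∈ Ioo 0 t, -∫ s in (0 : ℝ)..r, ψ s ≤ ∫ s in r..t, |ψ s| := by
    intro r hr
    have h1 : ∫ s in (0 : ℝ)..r, -ψ s ≤
        (z t - z r) * (t - r) ^ (-ρ) - (z t - z 0) * (t - 0) ^ (-ρ) := by
      refine intervalIntegral.integral_le_sub_of_hasDeriv_right_of_le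
        (g := fun s => (z t - z s) * (t - s) ^ (-ρ))
        (g' := fun s => -deriv z s * (t - s) ^ (-ρ) + (z t - z s) * (ρ * (t - s) ^ (-ρ - 1)))
        hr.1.le ?_ (fun s hs => ?_) (hiI.mono_set (Icc_subset_Icc_right hr.2.le)).neg
        (fun s hs => ?_)
      · refine (continuousOn_const.sub (hz.mono (Icc_subset_Icc_right hr.2.le))).mul ?_
        exact fun s hs => (hw s (hs.2.trans_lt hr.2)).continuousAt.continuousWithinAt
      · have hst := hs.2.trans hr.2
        exact (((hd s ⟨hs.1, hst⟩).hasDerivAt.const_sub (z t)).mul (hw s hst)).hasDerivWithinAt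
      · have hst := hs.2.trans hr.2
        have h2 : 0 ≤ z t - z s := sub_nonneg.2 (hmax s ⟨hs.1.le, hst.le⟩)
        have h3 := Real.rpow_nonneg (sub_pos.2 hst).le (-ρ - 1)
        simp only [hψ, hinv s hst, smul_eq_mul]
        have : 0 ≤ (z t - z s) * (ρ * (t - s) ^ (-ρ - 1)) := by positivity
        linarith [mul_comm (deriv z s) ((t - s) ^ (-ρ))]
    have h4 : z t * (t - r) ^ (-ρ) - z r * (t - r) ^ (-ρ) ≤ ∫ s in r..t, |ψ s| := by
      refine intervalIntegral.sub_le_integral_of_hasDeriv_right_of_le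
        (g := fun s => z s * (t - r) ^ (-ρ)) (g' := fun s => deriv z s * (t - r) ^ (-ρ))
        hr.2.le ((hz.mono (Icc_subset_Icc_left hr.1.le)).mul continuousOn_const)
        (fun s hs => ?_) (hiI.mono_set (Icc_subset_Icc_left hr.1.le)).abs (fun s hs => ?_)
      · exact ((hd s ⟨hr.1.trans hs.1, hs.2⟩).hasDerivAt.mul_const _).hasDerivWithinAt
      · have h5 : (t - r) ^ (-ρ) ≤ (t - s) ^ (-ρ) :=
          Real.rpow_le_rpow_of_nonpos (sub_pos.2 hs.2) (by linarith [hs.1]) (by linarith)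
        have h6 := Real.rpow_nonneg (sub_pos.2 hr.2).le (-ρ)
        simp only [hψ, hinv s hs.2, smul_eq_mul]
        rw [abs_mul, abs_of_nonneg (h6.trans h5), mul_comm]
        exact (mul_le_mul_of_nonneg_left (le_abs_self _) h6).trans
          (mul_le_mul_of_nonneg_right h5 (abs_nonneg _))
    have h7 : 0 ≤ (z t - z 0) * (t - 0) ^ (-ρ) :=
      mul_nonneg (sub_nonneg.2 (hmax 0 ⟨le_rfl, ht.le⟩)) (Real.rpow_nonneg (by linarith) _)
    rw [intervalIntegral.integral_neg] at h1
    linarith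
  have hcont1 : ContinuousOn (fun r => -∫ s in (0 : ℝ)..r, ψ s) (Icc 0 t) := by
    have := intervalIntegral.continuousOn_primitive_interval (f := ψ)
      (a := 0) (b := t) (μ := volume) (by rw [uIcc_of_le ht.le]; exact hiI)
    rw [uIcc_of_le ht.le] at this
    exact this.neg
  have hcont2 : ContinuousOn (fun r => ∫ s in r..t, |ψ s|) (Icc 0 t) := by
    have := intervalIntegral.continuousOn_primitive_interval_left (f := fun s => |ψ s|)
      (a := 0) (b := t) (μ := volume) (by rw [uIcc_of_le ht.le]; exact hiI.abs)
    rwa [uIcc_of_le ht.le] at this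
  have hmem : t ∈ closure (Ioo 0 t) := by
    rw [closure_Ioo ht.ne]; exact right_mem_Icc.2 ht.le
  have := ContinuousWithinAt.closure_le hmem
    ((hcont1 t (right_mem_Icc.2 ht.le)).mono Ioo_subset_Icc_self)
    ((hcont2 t (right_mem_Icc.2 ht.le)).mono Ioo_subset_Icc_self) hbound
  simp only [intervalIntegral.integral_same] at this
  linarith

theorem nonpos_of_caputoDeriv_eq {ρ l T : ℝ} {z : ℝ → ℝ} (hρ : ρ ∈ Ioo (0 : ℝ) 1) (hl : 0 < l)
    (hz : ContinuousOn z (Icc 0 T)) (hex : ∀ t ∈ Ioc 0 T, CaputoExistsAt ρ z t)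
    (heq : ∀ t ∈ Ioc 0 T, caputoDeriv ρ z t = -l * z t) (h0 : z 0 ≤ 0) :
    ∀ t ∈ Icc 0 T, z t ≤ 0 := by
  intro t ht
  by_contra hcon
  push Not at hcon
  obtain ⟨τ, hτ, hmax⟩ := isCompact_Icc.exists_isMaxOn ⟨t, ht⟩ hz
  have hzτ : 0 < z τ := hcon.trans_le (hmax ht)
  have hτ0 : 0 < τ := lt_of_le_of_ne hτ.1 fun h => by rw [← h] at hzτ; linarith
  have h1 := integral_nonneg_of_isMax hρ.1 hτ0 (hz.mono (Icc_subset_Icc_right hτ.2))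
    (hex τ ⟨hτ0, hτ.2⟩) fun s hs => hmax ⟨hs.1, hs.2.trans hτ.2⟩
  have h2 := heq τ ⟨hτ0, hτ.2⟩
  rw [caputoDeriv, smul_eq_mul] at h2
  have hG := Real.Gamma_pos_of_pos (sub_pos.2 hρ.2)
  have h3 : 0 ≤ -l * z τ := h2 ▸ mul_nonneg (by positivity) h1
  nlinarith [mul_pos hl hzτ]

section Linear

variable {H F : Type*} [NormedAddCommGroup H] [NormedSpace ℝ H] [NormedAddCommGroup F]
  [NormedSpace ℝ F]

theorem caputoDeriv_congr_deriv {ρ t : ℝ} {h : ℝ → H} {h' : ℝ → H} (ht : 0 < t)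
    (hh : ∀ s ∈ Ioo 0 t, HasDerivAt h (h' s) s) :
    (CaputoExistsAt ρ h t ↔
      IntervalIntegrable (fun s => (1 / (t - s) ^ ρ) • h' s) volume 0 t) ∧
    caputoDeriv ρ h t =
      (1 / Real.Gamma (1 - ρ)) • ∫ s in (0 : ℝ)..t, (1 / (t - s) ^ ρ) • h' s := by
  -- the end point `t`, where `h` need not be differentiable, is a null set
  have hae : ∀ᵐ s ∂volume, s ∈ uIoc 0 t →
      (1 / (t - s) ^ ρ) • deriv h s = (1 / (t - s) ^ ρ) • h' s := by
    filter_upwards [Measure.ae_ne volume t] with s hst hs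
    rw [uIoc_of_le ht.le] at hs
    rw [(hh s ⟨hs.1, lt_of_le_of_ne hs.2 hst⟩).deriv]
  refine ⟨⟨fun h1 => ?_, fun h1 => ⟨fun s hs => (hh s hs).differentiableAt, ?_⟩⟩, ?_⟩
  · exact h1.2.congr_ae ((ae_restrict_iff' measurableSet_uIoc).2 hae)
  · refine h1.congr_ae ((ae_restrict_iff' measurableSet_uIoc).2 ?_)
    filter_upwards [hae] with s hs h using (hs h).symm
  · rw [caputoDeriv, intervalIntegral.integral_congr_ae hae]

theorem CaputoExistsAt.clm_comp [CompleteSpace H] [CompleteSpace F] (L : H →L[ℝ] F) {ρ t : ℝ}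
    {u : ℝ → H} (ht : 0 < t) (hu : CaputoExistsAt ρ u t) :
    CaputoExistsAt ρ (fun s => L (u s)) t ∧
      caputoDeriv ρ (fun s => L (u s)) t = L (caputoDeriv ρ u t) := by
  obtain ⟨h1, h2⟩ := caputoDeriv_congr_deriv (ρ := ρ) (h := fun s => L (u s))
    (h' := fun s => L (deriv u s)) ht
    fun s hs => L.hasFDerivAt.comp_hasDerivAt s (hu.1 s hs).hasDerivAt
  rw [h1, h2, caputoDeriv, map_smul, ← L.intervalIntegral_comp_comm hu.2]
  simp only [map_smul]
  refine ⟨?_, trivial⟩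
  have := L.integrable_comp (intervalIntegrable_iff.1 hu.2)
  simp only [map_smul] at this
  exact intervalIntegrable_iff.2 this

end Linear

theorem intervalIntegrable_kernel_smul_relaxationRate {ρ : ℝ} (hρ : ρ ∈ Ioo (0 : ℝ) 1) (l : ℝ)
    {t : ℝ} (ht : 0 < t) :
    IntervalIntegrable (fun s => (1 / (t - s) ^ ρ) • relaxationRate ρ l s) volume 0 t := by
  refine (intervalIntegrable_rpow_mul_relaxationRate hρ l (sub_pos.2 hρ.2) ht).congr
    fun s hs => ?_
  rw [uIoc_of_le ht.le] at hs
  simp only [smul_eq_mul, one_div]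
  rw [← Real.rpow_neg (sub_nonneg.2 hs.2), show (1 : ℝ) - ρ - 1 = -ρ by ring]

/-- The equation `D_t^ρ b = -l b`, written with the rate `-b'`. -/
theorem integral_kernel_smul_relaxationRate {ρ : ℝ} (hρ : ρ ∈ Ioo (0 : ℝ) 1) (l : ℝ)
    {t : ℝ} (ht : 0 < t) :
    (1 / Real.Gamma (1 - ρ)) * ∫ s in (0 : ℝ)..t, (1 / (t - s) ^ ρ) • relaxationRate ρ l s =
      l * mlB ρ l t := by
  have : ∫ s in (0 : ℝ)..t, (1 / (t - s) ^ ρ) • relaxationRate ρ l s =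
      ∫ s in (0 : ℝ)..t, (t - s) ^ (-ρ) * relaxationRate ρ l s := by
    refine intervalIntegral.integral_congr fun s hs => ?_
    rw [uIcc_of_le ht.le] at hs
    simp only [smul_eq_mul, one_div]
    rw [← Real.rpow_neg (sub_nonneg.2 hs.2)]
  rw [this, integral_rpow_neg_mul_relaxationRate hρ l ht, ← mul_assoc,
    one_div_mul_cancel (Real.Gamma_pos_of_pos (sub_pos.2 hρ.2)).ne', one_mul]

/-- The initial value problem `D_t^ρ z + l z = c` has at most the solution `z(0) b + c a`: the
difference `w` satisfies `D_t^ρ w = -l w` and `w(0) = 0`, and the extremum principle applies to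
`w` and `-w`. -/
theorem eq_of_caputoDeriv_eq {ρ l T c : ℝ} {z : ℝ → ℝ} (hρ : ρ ∈ Ioo (0 : ℝ) 1) (hl : 0 < l)
    (hz : ContinuousOn z (Icc 0 T)) (hex : ∀ t ∈ Ioc 0 T, CaputoExistsAt ρ z t)
    (heq : ∀ t ∈ Ioc 0 T, caputoDeriv ρ z t = c - l * z t) :
    ∀ t ∈ Icc 0 T, z t = mlB ρ l t * z 0 + mlA ρ l t * c := by
  set κ := z 0 - c / l with hκ
  set w : ℝ → ℝ := fun t => z t - c / l - κ * mlB ρ l t with hw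
  have hwc : ContinuousOn w (Icc 0 T) :=
    (hz.sub continuousOn_const).sub (continuousOn_const.mul (continuous_mlB hρ l).continuousOn)
  have hw0 : w 0 = 0 := by simp only [hw, mlB_zero hρ, hκ]; ring
  have hcap : ∀ ε : ℝ, ∀ t ∈ Ioc 0 T, CaputoExistsAt ρ (fun s => ε * w s) t ∧
      caputoDeriv ρ (fun s => ε * w s) t = -l * (ε * w t) := by
    intro ε t ht
    obtain ⟨h1, h2⟩ := caputoDeriv_congr_deriv (ρ := ρ) (h := fun s => ε * w s)
      (h' := fun s => ε * (deriv z s + κ * relaxationRate ρ l s)) ht.1 (fun s hs => by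
        have h3 := ((((hex t ht).1 s hs).hasDerivAt.sub_const (c / l)).sub
          ((hasDerivAt_mlB hρ l hs.1).const_mul κ)).const_mul ε
        rw [mul_neg, sub_neg_eq_add] at h3
        exact h3)
    have hfun : (fun s => (1 / (t - s) ^ ρ) • (ε * (deriv z s + κ * relaxationRate ρ l s))) =
        fun s => ε * ((1 / (t - s) ^ ρ) • deriv z s +
          κ * ((1 / (t - s) ^ ρ) • relaxationRate ρ l s)) := by
      funext s
      simp only [smul_eq_mul]
      ring
    have hi1 := (hex t ht).2
    have hi2 := (intervalIntegrable_kernel_smul_relaxationRate hρ l ht.1).const_mul κ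
    have he := heq t ht
    rw [caputoDeriv, smul_eq_mul] at he
    have hr := integral_kernel_smul_relaxationRate hρ l ht.1
    rw [h1, h2, hfun, intervalIntegral.integral_const_mul, intervalIntegral.integral_add hi1 hi2,
      intervalIntegral.integral_const_mul, smul_eq_mul]
    refine ⟨(hi1.add hi2).const_mul ε, ?_⟩
    calc _ = ε * ((1 / Real.Gamma (1 - ρ) * ∫ s in (0 : ℝ)..t, (1 / (t - s) ^ ρ) • deriv z s) +
          κ * (1 / Real.Gamma (1 - ρ) *
            ∫ s in (0 : ℝ)..t, (1 / (t - s) ^ ρ) • relaxationRate ρ l s)) := by ring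
      _ = _ := by rw [he, hr]; simp only [hw]; field_simp; ring
  have hle : ∀ ε : ℝ, ∀ t ∈ Icc 0 T, ε * w t ≤ 0 := fun ε =>
    nonpos_of_caputoDeriv_eq hρ hl (continuousOn_const.mul hwc) (fun t ht => (hcap ε t ht).1)
      (fun t ht => (hcap ε t ht).2) (by rw [hw0, mul_zero])
  intro t ht
  have h1 := hle 1 t ht
  have h2 := hle (-1) t ht
  have h3 : w t = 0 := by linarith
  rw [mlA_eq hρ hl]
  simp only [hw, hκ] at h3
  field_simp at h3 ⊢
  linarith

/-! ### Operators that are diagonal in a Hilbert basis -/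

section Diagonal

variable {ι 𝕜 H : Type*} [RCLike 𝕜] [NormedAddCommGroup H] [InnerProductSpace 𝕜 H]

/-- The diagonal operator with real multipliers `m`: it multiplies the `k`-th Fourier coefficient
by `m k`. The series defining it is only meaningful for bounded `m`. -/
noncomputable def diagonalOp (v : HilbertBasis ι 𝕜 H) (m : ι → ℝ) (z : H) : H :=
  ∑' k, (m k • inner 𝕜 (v k) z) • v k

variable (v : HilbertBasis ι 𝕜 H)

theorem HilbertBasis.ext_inner {x y : H} (h : ∀ k, inner 𝕜 (v k) x = inner 𝕜 (v k) y) : x = y := by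
  refine v.repr.injective (lp.ext (funext fun k => ?_))
  rw [v.repr_apply_apply, v.repr_apply_apply, h]

theorem HilbertBasis.hasSum_norm_inner_sq (x : H) :
    HasSum (fun k => ‖inner 𝕜 (v k) x‖ ^ 2) (‖x‖ ^ 2) := by
  have h := (v.hasSum_inner_mul_inner x x).mapL (RCLike.reCLM (K := 𝕜))
  simp only [RCLike.reCLM_apply, inner_self_eq_norm_sq] at h
  refine h.congr_fun fun k => ?_
  rw [← inner_conj_symm x (v k), RCLike.conj_mul]
  norm_cast

variable {v} {m : ι → ℝ} {C : ℝ}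

theorem hasSum_diagonalOp_and_inner_diagonalOp (hm : ∀ k, |m k| ≤ C) (z : H) :
    HasSum (fun k => (m k • inner 𝕜 (v k) z) • v k) (diagonalOp v m z) ∧
      ∀ k, inner 𝕜 (v k) (diagonalOp v m z) = m k • inner 𝕜 (v k) z := by
  have hmem : Memℓp (fun k => m k • inner 𝕜 (v k) z) 2 := by
    refine memℓp_gen ?_
    simp only [ENNReal.toReal_ofNat, Real.rpow_ofNat, norm_smul, mul_pow]
    refine Summable.of_nonneg_of_le (fun k => by positivity) (fun k => ?_)
      ((v.hasSum_norm_inner_sq z).summable.mul_left (C ^ 2))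
    have := hm k
    rw [Real.norm_eq_abs]
    gcongr
  have h := v.hasSum_repr_symm ⟨_, hmem⟩
  have he : diagonalOp v m z = v.repr.symm ⟨_, hmem⟩ := h.tsum_eq
  refine ⟨he ▸ h, fun k => ?_⟩
  rw [he, ← v.repr_apply_apply, LinearIsometryEquiv.apply_symm_apply]

theorem inner_diagonalOp (hm : ∀ k, |m k| ≤ C) (z : H) (k : ι) :
    inner 𝕜 (v k) (diagonalOp v m z) = m k • inner 𝕜 (v k) z :=
  (hasSum_diagonalOp_and_inner_diagonalOp hm z).2 k

theorem diagonalOp_sub {m' : ι → ℝ} {C' : ℝ} (hm : ∀ k, |m k| ≤ C) (hm' : ∀ k, |m' k| ≤ C') (z : H) :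
    diagonalOp v (fun k => m k - m' k) z = diagonalOp v m z - diagonalOp v m' z := by
  refine v.ext_inner fun k => ?_
  rw [inner_sub_right, inner_diagonalOp hm, inner_diagonalOp hm',
    inner_diagonalOp (C := C + C') fun k => (abs_sub _ _).trans (add_le_add (hm k) (hm' k)), sub_smul]

theorem norm_diagonalOp_le (hm : ∀ k, |m k| ≤ C) (z : H) (hC : 0 ≤ C) : ‖diagonalOp v m z‖ ≤ C * ‖z‖ := by
  rw [← sq_le_sq₀ (norm_nonneg _) (by positivity), mul_pow]
  refine hasSum_le (fun k => ?_) (v.hasSum_norm_inner_sq (diagonalOp v m z))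
    ((v.hasSum_norm_inner_sq z).mul_left (C ^ 2))
  rw [inner_diagonalOp hm, norm_smul, mul_pow, Real.norm_eq_abs]
  have := hm k
  gcongr

theorem diagonalOp_const_mul [NormedSpace ℝ H] [IsScalarTower ℝ 𝕜 H] (r : ℝ)
    (hm : ∀ k, |m k| ≤ C) (z : H) :
    diagonalOp v (fun k => r * m k) z = r • diagonalOp v m z := by
  refine v.ext_inner fun k => ?_
  rw [← algebraMap_smul 𝕜 r (diagonalOp v m z), inner_smul_right, inner_diagonalOp hm,
    inner_diagonalOp (C := |r| * C) fun k => by rw [abs_mul]; gcongr; exact hm k, mul_smul,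
    ← smul_eq_mul, algebraMap_smul]

variable {X : Type*} {l : Filter X} {M : X → ι → ℝ}

/-- Dominated convergence for diagonal operators: bounded pointwise convergence of the multipliers
gives strong convergence. -/
theorem tendsto_diagonalOp_zero (h : ∀ k, Tendsto (fun x => M x k) l (nhds 0))
    (hC : ∀ᶠ x in l, ∀ k, |M x k| ≤ C) (z : H) :
    Tendsto (fun x => diagonalOp v (M x) z) l (nhds 0) := by
  have hs := (v.hasSum_norm_inner_sq z).summable.mul_left (C ^ 2)
  have h1 : Tendsto (fun x => ∑' k, (M x k) ^ 2 * ‖inner 𝕜 (v k) z‖ ^ 2) l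
      (nhds (∑' _ : ι, (0 : ℝ))) := by
    refine tendsto_tsum_of_dominated_convergence hs (fun k => ?_) ?_
    · simpa using ((h k).pow 2).mul_const (‖inner 𝕜 (v k) z‖ ^ 2)
    · filter_upwards [hC] with x hx k
      rw [norm_mul, norm_pow, norm_pow, norm_norm, Real.norm_eq_abs]
      have := hx k
      gcongr
  rw [tsum_zero] at h1
  have h2 : Tendsto (fun x => ‖diagonalOp v (M x) z‖ ^ 2) l (nhds 0) := by
    refine h1.congr' ?_
    filter_upwards [hC] with x hx
    rw [← (v.hasSum_norm_inner_sq (diagonalOp v (M x) z)).tsum_eq]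
    refine tsum_congr fun k => ?_
    rw [inner_diagonalOp hx, norm_smul, mul_pow, Real.norm_eq_abs, sq_abs]
  rw [tendsto_zero_iff_norm_tendsto_zero]
  simpa [Real.sqrt_sq (norm_nonneg _)] using h2.sqrt

theorem tendsto_diagonalOp {m : ι → ℝ} (h : ∀ k, Tendsto (fun x => M x k) l (nhds (m k)))
    (hC : ∀ᶠ x in l, ∀ k, |M x k| ≤ C) (hm : ∀ k, |m k| ≤ C) (z : H) :
    Tendsto (fun x => diagonalOp v (M x) z) l (nhds (diagonalOp v m z)) := by
  have h1 := tendsto_diagonalOp_zero (v := v) (l := l) (M := fun x k => M x k - m k) (C := C + C)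
    (fun k => by simpa using (h k).sub_const (m k)) (by
      filter_upwards [hC] with x hx k using (abs_sub _ _).trans (add_le_add (hx k) (hm k))) z
  have h2 : Tendsto (fun x => diagonalOp v (M x) z - diagonalOp v m z) l (nhds 0) := by
    refine h1.congr' ?_
    filter_upwards [hC] with x hx using diagonalOp_sub hx hm z
  simpa using h2.add_const (diagonalOp v m z)

theorem hasDerivAt_diagonalOp [NormedSpace ℝ H] [IsScalarTower ℝ 𝕜 H] {M : ℝ → ι → ℝ} {m' : ι → ℝ}
    {t B : ℝ} (h : ∀ k, HasDerivAt (fun s => M s k) (m' k) t)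
    (hB : ∀ᶠ s in nhds t, ∀ k, |M s k| ≤ B)
    (hC : ∀ᶠ s in nhds t, ∀ k, |M s k - M t k| ≤ C * |s - t|) (hm' : ∀ k, |m' k| ≤ C) (z : H) :
    HasDerivAt (fun s => diagonalOp v (M s) z) (diagonalOp v m' z) t := by
  rw [hasDerivAt_iff_tendsto_slope]
  have hlim := tendsto_diagonalOp (v := v) (l := nhdsWithin t {t}ᶜ) (C := C)
    (M := fun s k => (s - t)⁻¹ * (M s k - M t k)) (m := m')
    (fun k => by simpa [slope_fun_def] using hasDerivAt_iff_tendsto_slope.1 (h k)) ?_ hm' z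
  · refine hlim.congr' ?_
    filter_upwards [nhdsWithin_le_nhds hB, nhdsWithin_le_nhds hC] with s hs hs2
    rw [diagonalOp_const_mul _ hs2, diagonalOp_sub hs hB.self_of_nhds, slope_def_module]
  · filter_upwards [nhdsWithin_le_nhds hC, self_mem_nhdsWithin] with s hs hst k
    have : 0 < |s - t| := abs_pos.2 (sub_ne_zero.2 hst)
    rw [abs_mul, abs_inv, inv_mul_le_iff₀ this, mul_comm]
    exact hs k

end Diagonal

/-! ### Self-adjoint operators with a basis of eigenvectors -/

section SelfAdjoint

variable {ι 𝕜 H : Type*} [RCLike 𝕜] [NormedAddCommGroup H] [InnerProductSpace 𝕜 H]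
  [CompleteSpace H] {A : H →ₗ.[𝕜] H} (hA : IsSelfAdjoint A) {v : HilbertBasis ι 𝕜 H} {lam : ι → ℝ}
  (hv : ∀ k, ∃ hk : v k ∈ A.domain, A ⟨v k, hk⟩ = (lam k : 𝕜) • v k)
include hA hv

theorem inner_apply_eq_smul (x : A.domain) (k : ι) :
    inner 𝕜 (v k) (A x) = lam k • inner 𝕜 (v k) (x : H) := by
  obtain ⟨hk, hkv⟩ := hv k
  have h := LinearPMap.adjoint_isFormalAdjoint hA.dense_domain
  rw [LinearPMap.isSelfAdjoint_def.1 hA] at h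
  have h2 := h ⟨v k, hk⟩ x
  rw [hkv, inner_smul_left, RCLike.conj_ofReal] at h2
  rw [← h2, RCLike.real_smul_eq_coe_mul]

/-- The domain of a self-adjoint operator is maximal: a vector whose Fourier coefficients,
multiplied by the eigenvalues, are those of some `z ∈ H` lies in the domain and is mapped
to `z`. -/
theorem mem_domain_and_apply_eq {w z : H} (h : ∀ k, inner 𝕜 (v k) z = lam k • inner 𝕜 (v k) w) :
    ∃ hw : w ∈ A.domain, A ⟨w, hw⟩ = z := by
  have key : ∀ x : A.domain, inner 𝕜 z (x : H) = inner 𝕜 w (A x) := fun x => by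
    rw [← v.tsum_inner_mul_inner, ← v.tsum_inner_mul_inner]
    refine tsum_congr fun k => ?_
    rw [inner_apply_eq_smul hA hv, ← inner_conj_symm z, h, ← inner_conj_symm w]
    simp only [RCLike.real_smul_eq_coe_mul, map_mul, RCLike.conj_ofReal]
    ring
  have hw : w ∈ A.adjoint.domain := LinearPMap.mem_adjoint_domain_of_exists _ ⟨z, key⟩
  have he := LinearPMap.adjoint_apply_eq hA.dense_domain ⟨w, hw⟩ key
  have hAA := LinearPMap.isSelfAdjoint_def.1 hA
  revert hw
  rw [hAA]
  exact fun hw he => ⟨hw, he⟩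

end SelfAdjoint

/-! ### Regularity of the abstract relaxation function -/

section AbstractRelaxation

variable {ι 𝕜 H : Type*} [RCLike 𝕜] [NormedAddCommGroup H] [InnerProductSpace 𝕜 H]

/-- The solution `A⁻¹ f + b(t; A) A⁻¹ g` of `D_t^ρ u + A u = f` for the operator `A` with
eigenvalues `lam k` in the basis `v`; its initial value is `u(0) = A⁻¹ (f + g)`, so `f` and `g`
in `H` amount to a source in `H` and an initial value in the domain of `A`. -/
noncomputable def relaxation (v : HilbertBasis ι 𝕜 H) (lam : ι → ℝ) (ρ : ℝ) (f g : H) (t : ℝ) : H :=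
  diagonalOp v (fun k => 1 / lam k) f + diagonalOp v (fun k => mlB ρ (lam k) t / lam k) g

/-- The derivative of `relaxation`; it does not depend on the source. -/
noncomputable def relaxationDeriv (v : HilbertBasis ι 𝕜 H) (lam : ι → ℝ) (ρ : ℝ) (g : H) (t : ℝ) :
    H :=
  diagonalOp v (fun k => -(relaxationRate ρ (lam k) t / lam k)) g

variable (v : HilbertBasis ι 𝕜 H) {lam : ι → ℝ} {ρ c : ℝ}

theorem abs_relaxationRate_div_le (hρ : ρ ∈ Ioo (0 : ℝ) 1) {l s t : ℝ} (hl : 0 < l) (ht : 0 < t)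
    (hts : t ≤ s) : |-(relaxationRate ρ l s / l)| ≤ t ^ (ρ - 1) / Real.Gamma ρ := by
  have hs := ht.trans_le hts
  have hG := Real.Gamma_pos_of_pos hρ.1
  rw [abs_neg, abs_of_pos (div_pos (relaxationRate_pos hρ hl hs) hl), div_le_iff₀' hl]
  refine (relaxationRate_le hρ hl hs).trans ?_
  have := Real.rpow_le_rpow_of_nonpos ht hts (by linarith [hρ.2] : ρ - 1 ≤ 0)
  gcongr

theorem abs_mlB_le_one (hρ : ρ ∈ Ioo (0 : ℝ) 1) {l t : ℝ} (hl : 0 < l) (ht : 0 ≤ t) :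
    |mlB ρ l t| ≤ 1 := by
  rw [abs_of_pos (mlB_pos hρ hl ht)]
  exact mlB_le_one hρ hl ht

theorem abs_mlB_div_le (hρ : ρ ∈ Ioo (0 : ℝ) 1) {l t : ℝ} (hc : 0 < c) (hl : c ≤ l) (ht : 0 ≤ t) :
    |mlB ρ l t / l| ≤ 1 / c := by
  have hl0 := hc.trans_le hl
  rw [abs_div, abs_of_pos hl0]
  exact div_le_div₀ zero_le_one (abs_mlB_le_one hρ hl0 ht) hc hl

theorem abs_one_div_le {l : ℝ} (hc : 0 < c) (hl : c ≤ l) : |1 / l| ≤ 1 / c := by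
  have hl0 := hc.trans_le hl
  rw [abs_of_pos (by positivity)]
  gcongr

theorem continuousOn_diagonalOp_mlB (hρ : ρ ∈ Ioo (0 : ℝ) 1) (hlam : ∀ k, 0 < lam k) (g : H) :
    ContinuousOn (fun t => diagonalOp v (fun k => mlB ρ (lam k) t) g) (Ici 0) := fun t ht =>
  tendsto_diagonalOp (C := 1) (fun k => (continuous_mlB hρ (lam k)).continuousAt.continuousWithinAt)
    (by filter_upwards [self_mem_nhdsWithin] with s hs k using abs_mlB_le_one hρ (hlam k) hs)
    (fun k => abs_mlB_le_one hρ (hlam k) ht) g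

variable (hρ : ρ ∈ Ioo (0 : ℝ) 1) (hc : 0 < c) (hlam : ∀ k, c ≤ lam k)
include hρ hc hlam

theorem continuousOn_relaxation (f g : H) : ContinuousOn (relaxation v lam ρ f g) (Ici 0) :=
  continuousOn_const.add fun t ht =>
    tendsto_diagonalOp (C := 1 / c)
      (fun k => ((continuous_mlB hρ (lam k)).div_const _).continuousAt.continuousWithinAt)
      (by filter_upwards [self_mem_nhdsWithin] with s hs k using abs_mlB_div_le hρ hc (hlam k) hs)
      (fun k => abs_mlB_div_le hρ hc (hlam k) ht) g

theorem inner_relaxation (f g : H) {t : ℝ} (ht : 0 ≤ t) (k : ι) :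
    inner 𝕜 (v k) (relaxation v lam ρ f g t) =
      (1 / lam k) • inner 𝕜 (v k) f + (mlB ρ (lam k) t / lam k) • inner 𝕜 (v k) g := by
  rw [relaxation, inner_add_right, inner_diagonalOp fun k => abs_one_div_le hc (hlam k),
    inner_diagonalOp fun k => abs_mlB_div_le hρ hc (hlam k) ht]

theorem continuousOn_relaxationDeriv (g : H) :
    ContinuousOn (relaxationDeriv v lam ρ g) (Ioi 0) := fun t ht => by
  have ht2 : 0 < t / 2 := half_pos ht
  refine tendsto_diagonalOp (C := (t / 2) ^ (ρ - 1) / Real.Gamma ρ) (fun k => ?_) ?_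
    (fun k => abs_relaxationRate_div_le hρ (hc.trans_le (hlam k)) ht2 (half_lt_self ht).le) g
  · exact (((continuousOn_relaxationRate hρ (lam k)).div_const (lam k)).neg) t ht
  · filter_upwards [nhdsWithin_le_nhds (Ioi_mem_nhds (half_lt_self ht))] with s hs k
    exact abs_relaxationRate_div_le hρ (hc.trans_le (hlam k)) ht2 (le_of_lt hs)

variable [NormedSpace ℝ H]

theorem intervalIntegrable_kernel_smul_relaxationDeriv (g : H) {t : ℝ} (ht : 0 < t) :
    IntervalIntegrable (fun s => (1 / (t - s) ^ ρ) • relaxationDeriv v lam ρ g s) volume 0 t := by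
  have hG := Real.Gamma_pos_of_pos hρ.1
  have hdom := (intervalIntegrable_rpow_mul_sub_rpow (sub_pos.2 hρ.2) hρ.1 ht).mul_const
    (‖g‖ / Real.Gamma ρ)
  rw [intervalIntegrable_iff_integrableOn_Ioc_of_le ht.le] at hdom ⊢
  refine Integrable.mono' hdom (AEStronglyMeasurable.smul ?_ ?_) ?_
  · exact (by fun_prop : Measurable fun s : ℝ => 1 / (t - s) ^ ρ).aestronglyMeasurable
  · exact ((continuousOn_relaxationDeriv v hρ hc hlam g).mono fun s hs => hs.1).aestronglyMeasurable
      measurableSet_Ioc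
  · refine (ae_restrict_iff' measurableSet_Ioc).2 (Eventually.of_forall fun s hs => ?_)
    have hts : 0 ≤ t - s := sub_nonneg.2 hs.2
    have h1 := norm_diagonalOp_le (v := v) (fun k => abs_relaxationRate_div_le hρ
      (hc.trans_le (hlam k)) hs.1 le_rfl) g (div_nonneg (Real.rpow_nonneg hs.1.le _) hG.le)
    have h2 := Real.rpow_nonneg hts (-ρ)
    rw [norm_smul, Real.norm_eq_abs, one_div, ← Real.rpow_neg hts, abs_of_nonneg h2,
      show (1 : ℝ) - ρ - 1 = -ρ by ring]
    calc (t - s) ^ (-ρ) * ‖relaxationDeriv v lam ρ g s‖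
        ≤ (t - s) ^ (-ρ) * (s ^ (ρ - 1) / Real.Gamma ρ * ‖g‖) := mul_le_mul_of_nonneg_left h1 h2
      _ = _ := by ring

variable [IsScalarTower ℝ 𝕜 H]

theorem hasDerivAt_relaxation (f g : H) {t : ℝ} (ht : 0 < t) :
    HasDerivAt (relaxation v lam ρ f g) (relaxationDeriv v lam ρ g t) t := by
  have ht2 : 0 < t / 2 := half_pos ht
  have hd : ∀ k, ∀ s, 0 < s → HasDerivAt (fun s => mlB ρ (lam k) s / lam k)
      (-(relaxationRate ρ (lam k) s / lam k)) s := fun k s hs => by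
    have := (hasDerivAt_mlB hρ (lam k) hs).div_const (lam k)
    rwa [neg_div] at this
  refine (hasDerivAt_diagonalOp (B := 1 / c) (C := (t / 2) ^ (ρ - 1) / Real.Gamma ρ)
    (fun k => hd k t ht) ?_ ?_ (fun k => abs_relaxationRate_div_le hρ (hc.trans_le (hlam k)) ht2
      (half_lt_self ht).le) g).const_add _
  · filter_upwards [Ioi_mem_nhds ht] with s hs k using abs_mlB_div_le hρ hc (hlam k) (le_of_lt hs)
  · filter_upwards [Ioi_mem_nhds (half_lt_self ht)] with s hs k
    refine (convex_Ici (t / 2)).norm_image_sub_le_of_norm_hasDerivWithin_le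
      (fun x hx => (hd k x (ht2.trans_le hx)).hasDerivWithinAt)
      (fun x hx => abs_relaxationRate_div_le hρ (hc.trans_le (hlam k)) ht2 hx)
      (show t / 2 ≤ t from (half_lt_self ht).le) (show t / 2 ≤ s from le_of_lt hs)

/-- The Caputo derivative may be computed coordinate by coordinate. -/
theorem caputo_relaxation [CompleteSpace H] (f g : H) {t : ℝ} (ht : 0 < t) :
    CaputoExistsAt ρ (relaxation v lam ρ f g) t ∧
      caputoDeriv ρ (relaxation v lam ρ f g) t =
        -diagonalOp v (fun k => mlB ρ (lam k) t) g := by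
  have hi := intervalIntegrable_kernel_smul_relaxationDeriv v hρ hc hlam g ht
  obtain ⟨h1, h2⟩ := caputoDeriv_congr_deriv (ρ := ρ) ht fun s hs =>
    hasDerivAt_relaxation v hρ hc hlam f g hs.1
  refine ⟨h1.2 hi, v.ext_inner fun k => ?_⟩
  have hk := hc.trans_le (hlam k)
  let L : H →L[ℝ] 𝕜 := (innerSL 𝕜 (v k)).restrictScalars ℝ
  have hL : ∀ x, L x = inner 𝕜 (v k) x := fun x => rfl
  rw [inner_neg_right, inner_diagonalOp fun k => abs_mlB_le_one hρ (hc.trans_le (hlam k)) ht.le,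
    h2, ← hL, map_smul, ← L.intervalIntegral_comp_comm hi]
  have h3 : ∫ s in (0 : ℝ)..t, L ((1 / (t - s) ^ ρ) • relaxationDeriv v lam ρ g s) =
      ∫ s in (0 : ℝ)..t, (-(1 / lam k) * ((1 / (t - s) ^ ρ) • relaxationRate ρ (lam k) s)) •
        inner 𝕜 (v k) g := by
    refine intervalIntegral.integral_congr_ae (Eventually.of_forall fun s hs => ?_)
    rw [uIoc_of_le ht.le] at hs
    rw [map_smul, hL, relaxationDeriv, inner_diagonalOp fun k => abs_relaxationRate_div_le hρ
      (hc.trans_le (hlam k)) hs.1 le_rfl, smul_smul, smul_eq_mul]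
    congr 1
    ring
  rw [h3, intervalIntegral.integral_smul_const, intervalIntegral.integral_const_mul, smul_smul,
    ← neg_smul]
  congr 1
  have h4 := integral_kernel_smul_relaxationRate hρ (lam k) ht
  calc _ = -(1 / lam k) * (1 / Real.Gamma (1 - ρ) *
        ∫ s in (0 : ℝ)..t, (1 / (t - s) ^ ρ) • relaxationRate ρ (lam k) s) := by ring
    _ = _ := by rw [h4]; field_simp

end AbstractRelaxation

theorem apply_relaxation {ι 𝕜 H : Type*} [RCLike 𝕜] [NormedAddCommGroup H] [InnerProductSpace 𝕜 H]
    [CompleteSpace H] {A : H →ₗ.[𝕜] H} (hA : IsSelfAdjoint A) {v : HilbertBasis ι 𝕜 H}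
    {lam : ι → ℝ} (hv : ∀ k, ∃ hk : v k ∈ A.domain, A ⟨v k, hk⟩ = (lam k : 𝕜) • v k) {ρ c : ℝ}
    (hρ : ρ ∈ Ioo (0 : ℝ) 1) (hc : 0 < c) (hlam : ∀ k, c ≤ lam k) (f g : H) {t : ℝ} (ht : 0 ≤ t) :
    ∃ h : relaxation v lam ρ f g t ∈ A.domain,
      A ⟨relaxation v lam ρ f g t, h⟩ = f + diagonalOp v (fun k => mlB ρ (lam k) t) g := by
  refine mem_domain_and_apply_eq hA hv fun k => ?_
  have hk := (hc.trans_le (hlam k)).ne'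
  rw [inner_relaxation v hρ hc hlam f g ht, inner_add_right,
    inner_diagonalOp fun k => abs_mlB_le_one hρ (hc.trans_le (hlam k)) ht, smul_add, smul_smul,
    smul_smul, mul_one_div_cancel hk, mul_div_cancel₀ _ hk, one_smul]

/-! ### The inverse problem -/

section InverseProblem

variable {𝕜 H : Type*} [RCLike 𝕜] [NormedAddCommGroup H] [InnerProductSpace 𝕜 H]
  [NormedSpace ℝ H] [IsScalarTower ℝ 𝕜 H]

theorem inner_real_smul (x y : H) (r : ℝ) : inner 𝕜 x (r • y) = r • inner 𝕜 x y := by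
  rw [← algebraMap_smul 𝕜 r y, inner_smul_right, ← smul_eq_mul, algebraMap_smul]

/-- Each Fourier coefficient of a solution is the solution of a scalar fractional equation: apply
the scalar uniqueness result to its real and imaginary parts. -/
theorem IsInverseSolution.inner_eq [CompleteSpace H] {A : H →ₗ.[𝕜] H} (hA : IsSelfAdjoint A)
    {v : HilbertBasis ℕ 𝕜 H} {lam : ℕ → ℝ}
    (hv : ∀ k, ∃ hk : v k ∈ A.domain, A ⟨v k, hk⟩ = (lam k : 𝕜) • v k)
    (hlam : ∀ k, 0 < lam k) {ρ α T ξ₀ ξ₁ : ℝ} (hρ : ρ ∈ Ioo (0 : ℝ) 1) {φ V f : H} {u : ℝ → H}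
    (h : IsInverseSolution A ρ α T ξ₀ ξ₁ φ V u f) (k : ℕ) {t : ℝ} (ht : t ∈ Icc 0 T) :
    inner 𝕜 (v k) (u t) = mlB ρ (lam k) t • inner 𝕜 (v k) (u 0) +
      mlA ρ (lam k) t • inner 𝕜 (v k) f := by
  have key : ∀ P : 𝕜 →L[ℝ] ℝ, P (inner 𝕜 (v k) (u t)) =
      mlB ρ (lam k) t * P (inner 𝕜 (v k) (u 0)) + mlA ρ (lam k) t * P (inner 𝕜 (v k) f) := by
    intro P
    let L : H →L[ℝ] ℝ := P.comp ((innerSL 𝕜 (v k)).restrictScalars ℝ)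
    have hL : ∀ x, L x = P (inner 𝕜 (v k) x) := fun x => rfl
    simp only [← hL]
    refine eq_of_caputoDeriv_eq (z := fun s => L (u s)) hρ (hlam k)
      (L.continuous.comp_continuousOn h.continuousOn)
      (fun s hs => ((h.caputo_exists s hs).clm_comp L hs.1).1) (fun s hs => ?_) t ht
    rw [((h.caputo_exists s hs).clm_comp L hs.1).2, eq_sub_iff_add_eq]
    have h1 : L (A ⟨u s, h.mem_domain s hs⟩) = lam k * L (u s) := by
      rw [hL, inner_apply_eq_smul hA hv, map_smul, smul_eq_mul, hL]
    rw [← h1, ← map_add, h.equation s hs]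
  refine RCLike.ext ?_ ?_
  · simpa [RCLike.smul_re] using key RCLike.reCLM
  · simpa [RCLike.smul_im] using key RCLike.imCLM

/-- The linear system `(b₀ - α) U + a₀ F = p`, `b₁ U + a₁ F = q`, solved by Cramer's rule. -/
theorem eq_smul_of_linear_system {E : Type*} [AddCommGroup E] [Module ℝ E] {a₀ a₁ b₀ b₁ α d : ℝ}
    (hd : d = b₁ * a₀ + a₁ * (α - b₀)) (hne : d ≠ 0) {U F p q : E}
    (h0 : b₀ • U + a₀ • F = α • U + p) (h1 : b₁ • U + a₁ • F = q) :
    U = (a₀ / d) • q - (a₁ / d) • p ∧ F = ((α - b₀) / d) • q + (b₁ / d) • p := by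
  obtain rfl : p = b₀ • U + a₀ • F - α • U := by rw [h0]; abel
  subst h1
  constructor
  · match_scalars
    · field_simp
      linear_combination hd
    · ring
  · match_scalars
    · field_simp
      linear_combination hd
    · ring

end InverseProblem

section Existence

variable {𝕜 H : Type*} [RCLike 𝕜] [NormedAddCommGroup H] [InnerProductSpace 𝕜 H]
  [CompleteSpace H] [NormedSpace ℝ H] [IsScalarTower ℝ 𝕜 H]

/-- In each coordinate the initial value and the source are determined by the data. -/
theorem IsInverseSolution.inner_initial_and_source {A : H →ₗ.[𝕜] H} (hA : IsSelfAdjoint A)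
    {v : HilbertBasis ℕ 𝕜 H} {lam : ℕ → ℝ}
    (hv : ∀ k, ∃ hk : v k ∈ A.domain, A ⟨v k, hk⟩ = (lam k : 𝕜) • v k)
    (hlam : ∀ k, 0 < lam k) {ρ α T ξ₀ ξ₁ : ℝ} (hρ : ρ ∈ Ioo (0 : ℝ) 1) (hα : 0 < α)
    (hξ₁ : 0 < ξ₁) (hξ : ξ₁ < ξ₀) (hξ₀ : ξ₀ ≤ T) {φ V f : H} {u : ℝ → H}
    (h : IsInverseSolution A ρ α T ξ₀ ξ₁ φ V u f) (k : ℕ) {d : ℝ}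
    (hd : d = mlB ρ (lam k) ξ₁ * mlA ρ (lam k) ξ₀ + mlA ρ (lam k) ξ₁ * (α - mlB ρ (lam k) ξ₀)) :
    inner 𝕜 (v k) (u 0) = (mlA ρ (lam k) ξ₀ / d) • inner 𝕜 (v k) V -
        (mlA ρ (lam k) ξ₁ / d) • inner 𝕜 (v k) φ ∧
      inner 𝕜 (v k) f = ((α - mlB ρ (lam k) ξ₀) / d) • inner 𝕜 (v k) V +
        (mlB ρ (lam k) ξ₁ / d) • inner 𝕜 (v k) φ := by
  have hpos := mul_mlA_lt_determinant (α := α) hρ (hlam k) hξ₁ hξ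
  have ha := mlA_pos hρ (hlam k) hξ₁
  refine eq_smul_of_linear_system hd (by rw [hd]; nlinarith) ?_ ?_
  · rw [← h.inner_eq hA hv hlam hρ k ⟨(hξ₁.trans hξ).le, hξ₀⟩, h.nonlocal, inner_add_right,
      inner_real_smul]
  · rw [← h.inner_eq hA hv hlam hρ k ⟨hξ₁.le, hξ.le.trans hξ₀⟩, h.overdetermination]

/-- Since `V` and `φ` lie in the domain of `A`, the coordinates prescribed by Cramer's rule are
those of a source `f ∈ H` and of an initial value in the domain of `A`: the determinant is at least
`δ / lam k`, and the eigenvalue is absorbed by `A V` and `A φ`. -/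
theorem exists_isInverseSolution {A : H →ₗ.[𝕜] H} (hA : IsSelfAdjoint A)
    {v : HilbertBasis ℕ 𝕜 H} {lam : ℕ → ℝ}
    (hv : ∀ k, ∃ hk : v k ∈ A.domain, A ⟨v k, hk⟩ = (lam k : 𝕜) • v k)
    (hlam_pos : 0 < lam 0) (hlam_mono : Monotone lam) {ρ α T ξ₀ ξ₁ : ℝ}
    (hρ : ρ ∈ Ioo (0 : ℝ) 1) (hα : α ∈ Ioo (0 : ℝ) 1) (hξ₁ : 0 < ξ₁) (hξ : ξ₁ < ξ₀)
    {φ V : H} (hφ : φ ∈ A.domain) (hV : V ∈ A.domain) :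
    ∃ u f, IsInverseSolution A ρ α T ξ₀ ξ₁ φ V u f := by
  have hle : ∀ k, lam 0 ≤ lam k := fun k => hlam_mono (Nat.zero_le k)
  have hl : ∀ k, 0 < lam k := fun k => hlam_pos.trans_le (hle k)
  have hξ₀ : 0 < ξ₀ := hξ₁.trans hξ
  set d : ℕ → ℝ := fun k =>
    mlB ρ (lam k) ξ₁ * mlA ρ (lam k) ξ₀ + mlA ρ (lam k) ξ₁ * (α - mlB ρ (lam k) ξ₀) with hd
  set δ : ℝ := α * (1 - mlB ρ (lam 0) ξ₁) with hδ
  have hb01 : mlB ρ (lam 0) ξ₁ < 1 := by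
    have := mlB_strictAntiOn hρ hlam_pos self_mem_Ici hξ₁.le hξ₁
    rwa [mlB_zero hρ] at this
  have hδ0 : 0 < δ := mul_pos hα.1 (by linarith)
  have ha1 : ∀ k, 0 < mlA ρ (lam k) ξ₁ := fun k => mlA_pos hρ (hl k) hξ₁
  have hdα : ∀ k, α * mlA ρ (lam k) ξ₁ < d k := fun k => mul_mlA_lt_determinant hρ (hl k) hξ₁ hξ
  have hd0 : ∀ k, 0 < d k := fun k => (mul_pos hα.1 (ha1 k)).trans (hdα k)
  have hlA : ∀ k t, lam k * mlA ρ (lam k) t = 1 - mlB ρ (lam k) t := fun k t => by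
    rw [mlB_eq_one_sub hρ]; ring
  have hdδ : ∀ k, δ ≤ d k * lam k := fun k => by
    have h1 : mlB ρ (lam k) ξ₁ ≤ mlB ρ (lam 0) ξ₁ :=
      (mlB_strictAntiOn_left hρ hξ₁).antitoneOn hlam_pos.le (hl k).le (hle k)
    have h2 := mul_le_mul_of_nonneg_right (hdα k).le (hl k).le
    have h3 : α * mlA ρ (lam k) ξ₁ * lam k = α * (1 - mlB ρ (lam k) ξ₁) := by
      rw [← hlA k ξ₁]; ring
    rw [h3] at h2
    exact le_trans (mul_le_mul_of_nonneg_left (by linarith) hα.1.le) h2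
  -- the four multipliers are bounded by `1 / δ`
  have hbd : ∀ (x : ℝ) (k : ℕ), |x| ≤ 1 → |x / (d k * lam k)| ≤ 1 / δ := fun x k hx => by
    rw [abs_div, abs_of_pos (mul_pos (hd0 k) (hl k))]
    exact div_le_div₀ zero_le_one hx hδ0 (hdδ k)
  have hB : ∀ k, 0 < mlB ρ (lam k) ξ₀ ∧ mlB ρ (lam k) ξ₀ ≤ 1 := fun k =>
    ⟨mlB_pos hρ (hl k) hξ₀.le, mlB_le_one hρ (hl k) hξ₀.le⟩
  have hB1 : ∀ k, 0 < mlB ρ (lam k) ξ₁ ∧ mlB ρ (lam k) ξ₁ ≤ 1 := fun k =>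
    ⟨mlB_pos hρ (hl k) hξ₁.le, mlB_le_one hρ (hl k) hξ₁.le⟩
  have hm1 : ∀ k, |(α - mlB ρ (lam k) ξ₀) / (d k * lam k)| ≤ 1 / δ := fun k => hbd _ k
    (abs_le.2 ⟨by linarith [hα.1, (hB k).2], by linarith [hα.2, (hB k).1]⟩)
  have hm2 : ∀ k, |mlB ρ (lam k) ξ₁ / (d k * lam k)| ≤ 1 / δ := fun k => hbd _ k
    (abs_mlB_le_one hρ (hl k) hξ₁.le)
  have hm3 : ∀ k, |(1 - mlB ρ (lam k) ξ₀) / (d k * lam k)| ≤ 1 / δ := fun k => hbd _ k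
    (abs_le.2 ⟨by linarith [(hB k).2], by linarith [(hB k).1]⟩)
  have hm4 : ∀ k, |(1 - mlB ρ (lam k) ξ₁) / (d k * lam k)| ≤ 1 / δ := fun k => hbd _ k
    (abs_le.2 ⟨by linarith [(hB1 k).2], by linarith [(hB1 k).1]⟩)
  set f : H := diagonalOp v (fun k => (α - mlB ρ (lam k) ξ₀) / (d k * lam k)) (A ⟨V, hV⟩) +
    diagonalOp v (fun k => mlB ρ (lam k) ξ₁ / (d k * lam k)) (A ⟨φ, hφ⟩) with hf
  set g : H := diagonalOp v (fun k => (1 - mlB ρ (lam k) ξ₀) / (d k * lam k)) (A ⟨V, hV⟩) -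
    diagonalOp v (fun k => (1 - mlB ρ (lam k) ξ₁) / (d k * lam k)) (A ⟨φ, hφ⟩) - f with hg
  have hfk : ∀ k, inner 𝕜 (v k) f = ((α - mlB ρ (lam k) ξ₀) / d k) • inner 𝕜 (v k) V +
      (mlB ρ (lam k) ξ₁ / d k) • inner 𝕜 (v k) φ := fun k => by
    rw [hf, inner_add_right, inner_diagonalOp hm1, inner_diagonalOp hm2,
      inner_apply_eq_smul hA hv, inner_apply_eq_smul hA hv, smul_smul, smul_smul,
      ← div_div, div_mul_cancel₀ _ (hl k).ne', ← div_div, div_mul_cancel₀ _ (hl k).ne']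
  have hgk : ∀ k, inner 𝕜 (v k) g = ((1 - mlB ρ (lam k) ξ₀) / d k) • inner 𝕜 (v k) V -
      ((1 - mlB ρ (lam k) ξ₁) / d k) • inner 𝕜 (v k) φ - inner 𝕜 (v k) f := fun k => by
    rw [hg, inner_sub_right, inner_sub_right, inner_diagonalOp hm3, inner_diagonalOp hm4,
      inner_apply_eq_smul hA hv, inner_apply_eq_smul hA hv, smul_smul, smul_smul,
      ← div_div, div_mul_cancel₀ _ (hl k).ne', ← div_div, div_mul_cancel₀ _ (hl k).ne']
  have hdk : ∀ k, d k * lam k = mlB ρ (lam k) ξ₁ * (1 - mlB ρ (lam k) ξ₀) +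
      (1 - mlB ρ (lam k) ξ₁) * (α - mlB ρ (lam k) ξ₀) := fun k => by
    simp only [← hlA, hd]
    ring
  have huk := fun (t : ℝ) (ht : 0 ≤ t) k =>
    inner_relaxation v hρ hlam_pos hle f g ht k
  have hdom : ∀ t ∈ Ioc 0 T, ∃ h : relaxation v lam ρ f g t ∈ A.domain,
      A ⟨relaxation v lam ρ f g t, h⟩ = f + diagonalOp v (fun k => mlB ρ (lam k) t) g :=
    fun t ht => apply_relaxation hA hv hρ hlam_pos hle f g ht.1.le
  have hcap : ∀ t ∈ Ioc 0 T, _ := fun t ht => caputo_relaxation v hρ hlam_pos hle f g ht.1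
  have hcont := (continuousOn_diagonalOp_mlB v hρ hl g).mono
    (fun t ht => ht.1.le : Ioc 0 T ⊆ Ici 0)
  refine ⟨relaxation v lam ρ f g, f,
    (continuousOn_relaxation v hρ hlam_pos hle f g).mono fun t ht => ht.1,
    fun t ht => (hcap t ht).1, hcont.neg.congr fun t ht => (hcap t ht).2,
    fun t ht => (hdom t ht).1, ?_, fun t ht => ?_, ?_, ?_⟩
  · have h1 : Continuous fun t : Ioc 0 T => f + diagonalOp v (fun k => mlB ρ (lam k) t) g :=
      continuous_const.add (continuousOn_iff_continuous_domRestrict.1 hcont)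
    exact h1.congr fun t => (hdom t t.2).2.symm
  · rw [(hcap t ht).2, (hdom t ht).2]
    abel
  · refine v.ext_inner fun k => ?_
    have hk := (hl k).ne'
    have hdk0 := (hd0 k).ne'
    have hdd := hdk k
    rw [inner_add_right, inner_real_smul, huk _ hξ₀.le, huk _ le_rfl, hgk, hfk, mlB_zero hρ]
    match_scalars
    · field_simp
      ring
    · field_simp
      linear_combination -hdd
  · refine v.ext_inner fun k => ?_
    have hk := (hl k).ne'
    have hdk0 := (hd0 k).ne'
    have hdd := hdk k
    rw [huk _ hξ₁.le, hgk, hfk]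
    match_scalars
    · field_simp
      linear_combination -hdd
    · field_simp
      ring

end Existence

/-- Here `inner 𝕜 (v k) h` is the `k`-th Fourier coefficient of `h` (Mathlib's inner product is
linear in the second argument). -/
theorem theorem1 {𝕜 H : Type*} [RCLike 𝕜] [NormedAddCommGroup H] [InnerProductSpace 𝕜 H]
    [CompleteSpace H] [NormedSpace ℝ H] [IsScalarTower ℝ 𝕜 H]
    (A : H →ₗ.[𝕜] H) (hA : IsSelfAdjoint A)
    (v : HilbertBasis ℕ 𝕜 H) (lam : ℕ → ℝ)
    (hlam_pos : 0 < lam 0) (hlam_mono : Monotone lam) (hlam_top : Tendsto lam atTop atTop)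
    (hv : ∀ k, ∃ hk : v k ∈ A.domain, A ⟨v k, hk⟩ = (lam k : 𝕜) • v k)
    (ρ α T ξ₀ ξ₁ : ℝ) (hρ : ρ ∈ Ioo (0 : ℝ) 1) (hα : α ∈ Ioo (0 : ℝ) 1)
    (hξ₁ : 0 < ξ₁) (hξ : ξ₁ < ξ₀) (hξ₀ : ξ₀ ≤ T)
    (φ V : H) (hφ : φ ∈ A.domain) (hV : V ∈ A.domain)
    (hφ_orth : ∀ k ∈ criticalSet lam ρ α ξ₀, inner 𝕜 (v k) φ = 0) :
    -- the critical indices are finitely many and belong to a single eigenvalue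
    (criticalSet lam ρ α ξ₀).Finite ∧
    (∀ j ∈ criticalSet lam ρ α ξ₀, ∀ k, k ∈ criticalSet lam ρ α ξ₀ ↔ lam k = lam j) ∧
    -- monotonicity of `a`, `b`, and positivity of `b` and of the denominators below
    (∀ k, StrictMonoOn (mlA ρ (lam k)) (Ici 0) ∧ StrictAntiOn (mlB ρ (lam k)) (Ici 0) ∧
      (∀ t, 0 ≤ t → 0 < mlB ρ (lam k) t) ∧
      0 < mlB ρ (lam k) ξ₁ * mlA ρ (lam k) ξ₀
        + mlA ρ (lam k) ξ₁ * (α - mlB ρ (lam k) ξ₀)) ∧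
    -- existence, the explicit form of the solution, and uniqueness
    ∃ (u : ℝ → H) (f : H),
      IsInverseSolution A ρ α T ξ₀ ξ₁ φ V u f ∧
      (∀ k ∈ criticalSet lam ρ α ξ₀, inner 𝕜 (v k) f = 0) ∧
      HasSum (fun k : ↥(criticalSet lam ρ α ξ₀)ᶜ =>
        (((α - mlB ρ (lam k) ξ₀) /
            (mlB ρ (lam k) ξ₁ * mlA ρ (lam k) ξ₀
              + mlA ρ (lam k) ξ₁ * (α - mlB ρ (lam k) ξ₀))) • inner 𝕜 (v k) V
          + (mlB ρ (lam k) ξ₁ /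
            (mlB ρ (lam k) ξ₁ * mlA ρ (lam k) ξ₀
              + mlA ρ (lam k) ξ₁ * (α - mlB ρ (lam k) ξ₀))) • inner 𝕜 (v k) φ) • v k) f ∧
      (∀ t ∈ Icc 0 T,
        HasSum (fun k : ↥(criticalSet lam ρ α ξ₀)ᶜ =>
          ((mlB ρ (lam k) t / (mlB ρ (lam k) ξ₀ - α)) •
              (inner 𝕜 (v k) φ - mlA ρ (lam k) ξ₀ • inner 𝕜 (v k) f)
            + mlA ρ (lam k) t • inner 𝕜 (v k) f) • v k)
          (u t - ∑ᶠ k ∈ criticalSet lam ρ α ξ₀,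
            ((mlB ρ (lam k) t / mlB ρ (lam k) ξ₁) • inner 𝕜 (v k) V) • v k)) ∧
      (∀ (u' : ℝ → H) (f' : H), IsInverseSolution A ρ α T ξ₀ ξ₁ φ V u' f' →
        f' = f ∧ EqOn u' u (Icc 0 T)) := by
  have hle : ∀ k, lam 0 ≤ lam k := fun k => hlam_mono (Nat.zero_le k)
  have hl : ∀ k, 0 < lam k := fun k => hlam_pos.trans_le (hle k)
  have hξ₀0 : 0 < ξ₀ := hξ₁.trans hξ
  have hiff : ∀ j ∈ criticalSet lam ρ α ξ₀, ∀ k, k ∈ criticalSet lam ρ α ξ₀ ↔ lam k = lam j := by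
    intro j hj k
    have hj' : mlB ρ (lam j) ξ₀ = α := hj
    have := (mlB_strictAntiOn_left hρ hξ₀0).injOn.eq_iff (hl k).le (hl j).le
    rw [← this]
    change mlB ρ (lam k) ξ₀ = α ↔ _
    rw [← hj']
  have hfin : (criticalSet lam ρ α ξ₀).Finite := by
    rcases (criticalSet lam ρ α ξ₀).eq_empty_or_nonempty with h | ⟨j, hj⟩
    · rw [h]; exact finite_empty
    · obtain ⟨N, hN⟩ := eventually_atTop.1 (hlam_top.eventually_gt_atTop (lam j))
      refine (finite_Iio N).subset fun k hk => mem_Iio.2 (not_le.1 fun h => ?_)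
      exact (hN k h).ne' ((hiff j hj k).1 hk)
  have hdet : ∀ k, 0 < mlB ρ (lam k) ξ₁ * mlA ρ (lam k) ξ₀
      + mlA ρ (lam k) ξ₁ * (α - mlB ρ (lam k) ξ₀) := fun k =>
    (mul_pos hα.1 (mlA_pos hρ (hl k) hξ₁)).trans (mul_mlA_lt_determinant hρ (hl k) hξ₁ hξ)
  refine ⟨hfin, hiff, fun k => ⟨mlA_strictMonoOn hρ (hl k), mlB_strictAntiOn hρ (hl k),
    fun t ht => mlB_pos hρ (hl k) ht, hdet k⟩, ?_⟩
  obtain ⟨u, f, hsol⟩ :=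
    exists_isInverseSolution (T := T) hA hv hlam_pos hlam_mono hρ hα hξ₁ hξ hφ hV
  have hcoef := fun {u' : ℝ → H} {f' : H} (h : IsInverseSolution A ρ α T ξ₀ ξ₁ φ V u' f') k =>
    h.inner_initial_and_source hA hv hl hρ hα.1 hξ₁ hξ hξ₀ k rfl
  have hf0 : ∀ k ∈ criticalSet lam ρ α ξ₀, inner 𝕜 (v k) f = 0 := fun k hk => by
    have hk' : mlB ρ (lam k) ξ₀ = α := hk
    rw [(hcoef hsol k).2, hφ_orth k hk, hk', sub_self, zero_div, zero_smul, smul_zero, add_zero]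
  refine ⟨u, f, hsol, hf0, ?_, fun t ht => ?_, fun u' f' h' => ?_⟩
  · have h1 : HasSum (fun k => inner 𝕜 (v k) f • v k) f := by
      simpa only [v.repr_apply_apply] using v.hasSum_repr f
    have h2 : Function.support (fun k => inner 𝕜 (v k) f • v k) ⊆ (criticalSet lam ρ α ξ₀)ᶜ :=
      fun k hk hkc => hk (by simp only [hf0 k hkc, zero_smul])
    refine ((hasSum_subtype_iff_of_support_subset h2).2 h1).congr_fun fun k => ?_
    simp only [Function.comp, (hcoef hsol k).2]
  · have h1 : HasSum (fun k => inner 𝕜 (v k) (u t) • v k) (u t) := by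
      simpa only [v.repr_apply_apply] using v.hasSum_repr (u t)
    have hut := fun k => hsol.inner_eq hA hv hl hρ k ht
    have h2 : ∑ᶠ k ∈ criticalSet lam ρ α ξ₀,
        ((mlB ρ (lam k) t / mlB ρ (lam k) ξ₁) • inner 𝕜 (v k) V) • v k =
        ∑ k ∈ hfin.toFinset, inner 𝕜 (v k) (u t) • v k := by
      rw [finsum_mem_eq_finite_toFinset_sum _ hfin]
      refine Finset.sum_congr rfl fun k hk => ?_
      have hkc := hfin.mem_toFinset.1 hk
      have hV1 := hsol.inner_eq hA hv hl hρ k ⟨hξ₁.le, hξ.le.trans hξ₀⟩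
      rw [hsol.overdetermination] at hV1
      rw [hV1, hut, hf0 k hkc, smul_zero, smul_zero, add_zero, add_zero, smul_smul,
        div_mul_cancel₀ _ (mlB_pos hρ (hl k) hξ₁.le).ne']
    rw [h2]
    have h3 : HasSum ((fun k => inner 𝕜 (v k) (u t) • v k) ∘ ((↑) : criticalSet lam ρ α ξ₀ → ℕ))
        (∑ k ∈ hfin.toFinset, inner 𝕜 (v k) (u t) • v k) := by
      rw [hasSum_subtype_iff_indicator, ← Finset.sum_congr rfl fun k hk =>
        indicator_of_mem (hfin.mem_toFinset.1 hk) fun k => inner 𝕜 (v k) (u t) • v k]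
      exact hasSum_sum_of_ne_finset_zero fun k hk =>
        indicator_of_notMem (fun h => hk (hfin.mem_toFinset.2 h)) _
    refine (h3.hasSum_iff_compl.1 h1).congr_fun fun k => ?_
    have hkc : mlB ρ (lam k) ξ₀ - α ≠ 0 := fun h => k.2 (sub_eq_zero.1 h)
    have hφk := hsol.inner_eq hA hv hl hρ (k : ℕ) ⟨hξ₀0.le, hξ₀⟩
    rw [hsol.nonlocal, inner_add_right, inner_real_smul] at hφk
    simp only [Function.comp]
    rw [eq_sub_of_add_eq' hφk, hut]
    congr 1
    match_scalars
    · field_simp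
    · field_simp
      ring
  · have hff : f' = f := v.ext_inner fun k => by rw [(hcoef h' k).2, (hcoef hsol k).2]
    refine ⟨hff, fun t ht => v.ext_inner fun k => ?_⟩
    rw [h'.inner_eq hA hv hl hρ k ht, hsol.inner_eq hA hv hl hρ k ht, (hcoef h' k).1,
      (hcoef hsol k).1, hff]
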